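/- Let $R$ be an associative ring with identity. A module $N$ has FP-injective dimension $\mathrm{FP\text{-}id}(N)$ equal to the least integer $n\ge 0$ such that $\operatorname{Ext}^{n+1}_R(F,N)=0$ for all finitely presented modules $F$ (and $\infty$ if there is no such $n$). Suppose that $R$ is a Ding--Chen ring, that is, $R$ is left and right coherent and, for some integer $n \ge 0$, $\mathrm{FP\text{-}id}({}_RR)=\mathrm{FP\text{-}id}(R_R)=n$. Let $\mathcal{GF}$ be the class of Gorenstein flat left $R$-modules: those $M$ for which there is an exact sequence $\cdots\to F_1\to F_0\to F^0\to F^1\to\cdots$ of flat left $R$-modules with $M\cong\ker(F^0\to F^1)$ which remains exact after applying $E\otimes_R-$ for every injective right $R$-module $E$. Let $\mathcal{GC}$ be the class of Gorenstein cotorsion left $R$-modules: those $C$ with $\operatorname{Ext}^1_R(G,C)=0$ for all $G\in\mathcal{GF}$. Then $(\mathcal{GF},\mathcal{GC})$ is a complete hereditary cotorsion pair, that is: (1) $\mathcal{GF}$ is exactly the class of left $R$-modules $M$ with $\operatorname{Ext}^1_R(M,C)=0$ for all $C\in\mathcal{GC}$ (and $\mathcal{GC}$ is the class of all $C$ with $\operatorname{Ext}^1_R(G,C)=0$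 for all $G\in\mathcal{GF}$); (2) for every left $R$-module $M$ there are short exact sequences $0\to C\to G\to M\to 0$ and $0\to M\to C'\to G'\to 0$ with $G,G'\in\mathcal{GF}$ and $C,C'\in\mathcal{GC}$; (3) $\mathcal{GF}$ is closed under kernels of epimorphisms, $\mathcal{GC}$ is closed under cokernels of monomorphisms, and $\operatorname{Ext}^i_R(G,C)=0$ for all $G\in\mathcal{GF}$, $C\in\mathcal{GC}$ and $i\ge 1$. -/

import Mathlib

open CategoryTheory

universe u

namespace DingChen

/-! Left modules over `R` are `R`-modules; right modules over `R` are `Rᵐᵒᵖ`-modules, the right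
action being `e * r = MulOpposite.op r • e`. -/

section BalancedTensor

variable (R : Type u) [Ring R]

/-- The subgroup of `E ⊗[ℤ] F` generated by the elements `(e * r) ⊗ x - e ⊗ (r * x)`. -/
def balancedRelations (E F : Type u) [AddCommGroup E] [Module Rᵐᵒᵖ E]
    [AddCommGroup F] [Module R F] : AddSubgroup (TensorProduct ℤ E F) :=
  AddSubgroup.closure {t | ∃ (e : E) (r : R) (x : F),
    t = TensorProduct.tmul ℤ (MulOpposite.op r • e) x - TensorProduct.tmul ℤ e (r • x)}

/-- The tensor product `E ⊗_R F` (an abelian group) of a right `R`-module `E` and a left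
`R`-module `F` over a ring `R` that need not be commutative. -/
abbrev BalancedTensor (E F : Type u) [AddCommGroup E] [Module Rᵐᵒᵖ E]
    [AddCommGroup F] [Module R F] : Type u :=
  TensorProduct ℤ E F ⧸ balancedRelations R E F

variable {R}

theorem balancedRelations_le_comap {E E' F F' : Type u}
    [AddCommGroup E] [Module Rᵐᵒᵖ E] [AddCommGroup E'] [Module Rᵐᵒᵖ E']
    [AddCommGroup F] [Module R F] [AddCommGroup F'] [Module R F']
    (g : E →ₗ[Rᵐᵒᵖ] E') (f : F →ₗ[R] F') :
    balancedRelations R E F ≤ (balancedRelations R E' F').comap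
      (TensorProduct.map g.toAddMonoidHom.toIntLinearMap
        f.toAddMonoidHom.toIntLinearMap).toAddMonoidHom := by
  refine (AddSubgroup.closure_le _).mpr ?_
  rintro _ ⟨e, r, x, rfl⟩
  refine AddSubgroup.subset_closure ⟨g e, r, f x, ?_⟩
  simp

/-- The homomorphism `g ⊗ f : E ⊗_R F → E' ⊗_R F'`. -/
def BalancedTensor.map {E E' F F' : Type u}
    [AddCommGroup E] [Module Rᵐᵒᵖ E] [AddCommGroup E'] [Module Rᵐᵒᵖ E']
    [AddCommGroup F] [Module R F] [AddCommGroup F'] [Module R F']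
    (g : E →ₗ[Rᵐᵒᵖ] E') (f : F →ₗ[R] F') :
    BalancedTensor R E F →+ BalancedTensor R E' F' :=
  QuotientAddGroup.map _ _
    (TensorProduct.map g.toAddMonoidHom.toIntLinearMap
      f.toAddMonoidHom.toIntLinearMap).toAddMonoidHom
    (balancedRelations_le_comap g f)

/-- A left module `F` is flat if `- ⊗_R F` preserves injectivity of homomorphisms of right
modules. -/
def IsFlat (F : ModuleCat.{u} R) : Prop :=
  ∀ (A B : ModuleCat.{u} Rᵐᵒᵖ) (g : A →ₗ[Rᵐᵒᵖ] B), Function.Injective g →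
    Function.Injective (BalancedTensor.map g (LinearMap.id : F →ₗ[R] F))

end BalancedTensor

section Rings

variable (R : Type u) [Ring R]

/-- `R` is left coherent: every finitely generated left ideal is finitely presented.
(Applied to `Rᵐᵒᵖ` this is right coherence of `R`.) -/
def IsLeftCoherent : Prop :=
  ∀ I : Ideal R, I.FG → Module.FinitePresentation R I

variable {R}

/-- The FP-injective dimension of `N`: the least `n` such that `Ext^(n+1)(F, N) = 0` for all
finitely presented `F`, and `⊤` if there is no such `n`. -/
noncomputable def fpInjDim (N : ModuleCat.{u} R) : ℕ∞ :=
  sInf {m : ℕ∞ | ∃ n : ℕ, m = n ∧ ∀ F : ModuleCat.{u} R, Module.FinitePresentation R F →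
    Subsingleton (Abelian.Ext F N (n + 1))}

variable (R)

/-- `n`-FC rings: left and right coherent, with both self FP-injective dimensions equal to `n`. -/
structure IsFC (n : ℕ) : Prop where
  left_coherent : IsLeftCoherent R
  right_coherent : IsLeftCoherent Rᵐᵒᵖ
  left_dim : fpInjDim (ModuleCat.of R R) = n
  right_dim : fpInjDim (ModuleCat.of Rᵐᵒᵖ R) = n

/-- `R` is a Ding-Chen ring if it is an `n`-FC ring for some `n`. -/
def IsDingChenRing : Prop := ∃ n : ℕ, IsFC R n

end Rings

section Cotorsion

variable {R : Type u} [Ring R]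

/-- The class of `M` with `Ext^1(A, M) = 0` for all `A` in the class `𝒜`. -/
def rightPerp (𝒜 : ObjectProperty (ModuleCat.{u} R)) : ObjectProperty (ModuleCat.{u} R) :=
  fun M => ∀ A : ModuleCat.{u} R, 𝒜 A → Subsingleton (Abelian.Ext A M 1)

/-- The class of `M` with `Ext^1(M, B) = 0` for all `B` in the class `ℬ`. -/
def leftPerp (ℬ : ObjectProperty (ModuleCat.{u} R)) : ObjectProperty (ModuleCat.{u} R) :=
  fun M => ∀ B : ModuleCat.{u} R, ℬ B → Subsingleton (Abelian.Ext M B 1)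

/-- `(𝒜, ℬ)` is a cotorsion pair. -/
structure IsCotorsionPair (𝒜 ℬ : ObjectProperty (ModuleCat.{u} R)) : Prop where
  right_eq : rightPerp 𝒜 = ℬ
  left_eq : 𝒜 = leftPerp ℬ

/-- Every module `M` has a short exact sequence `0 → B → A → M → 0` with `B ∈ ℬ`, `A ∈ 𝒜`. -/
def HasEnoughProjectives (𝒜 ℬ : ObjectProperty (ModuleCat.{u} R)) : Prop :=
  ∀ M : ModuleCat.{u} R, ∃ (B A : ModuleCat.{u} R) (i : B →ₗ[R] A) (p : A →ₗ[R] M),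
    ℬ B ∧ 𝒜 A ∧ Function.Injective i ∧ Function.Exact i p ∧ Function.Surjective p

/-- Every module `M` has a short exact sequence `0 → M → B → A → 0` with `B ∈ ℬ`, `A ∈ 𝒜`. -/
def HasEnoughInjectives (𝒜 ℬ : ObjectProperty (ModuleCat.{u} R)) : Prop :=
  ∀ M : ModuleCat.{u} R, ∃ (B A : ModuleCat.{u} R) (i : M →ₗ[R] B) (p : B →ₗ[R] A),
    ℬ B ∧ 𝒜 A ∧ Function.Injective i ∧ Function.Exact i p ∧ Function.Surjective p

/-- `𝒜` is closed under kernels of epimorphisms. -/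
def IsResolving (𝒜 : ObjectProperty (ModuleCat.{u} R)) : Prop :=
  ∀ (X Y Z : ModuleCat.{u} R) (i : X →ₗ[R] Y) (p : Y →ₗ[R] Z),
    Function.Injective i → Function.Exact i p → Function.Surjective p → 𝒜 Y → 𝒜 Z → 𝒜 X

/-- `ℬ` is closed under cokernels of monomorphisms. -/
def IsCoresolving (ℬ : ObjectProperty (ModuleCat.{u} R)) : Prop :=
  ∀ (X Y Z : ModuleCat.{u} R) (i : X →ₗ[R] Y) (p : Y →ₗ[R] Z),
    Function.Injective i → Function.Exact i p → Function.Surjective p → ℬ X → ℬ Y → ℬ Z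

/-- `(𝒜, ℬ)` is a complete hereditary cotorsion pair. The three conditions that are customarily
used (each alone) to define `hereditary` are all included. -/
structure IsCompleteHereditaryCotorsionPair
    (𝒜 ℬ : ObjectProperty (ModuleCat.{u} R)) : Prop where
  cotorsionPair : IsCotorsionPair 𝒜 ℬ
  enoughProjectives : HasEnoughProjectives 𝒜 ℬ
  enoughInjectives : HasEnoughInjectives 𝒜 ℬ
  resolving : IsResolving 𝒜
  coresolving : IsCoresolving ℬ
  ext_vanishing : ∀ A B : ModuleCat.{u} R, 𝒜 A → ℬ B → ∀ i : ℕ, 1 ≤ i →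
    Subsingleton (Abelian.Ext A B i)

end Cotorsion

section GorensteinFlat

variable (R : Type u) [Ring R]

/-- The class `𝒢ℱ` of Gorenstein flat left modules: `M` is the kernel of `F 0 → F 1` in an exact
sequence `⋯ → F (-1) → F 0 → F 1 → ⋯` of flat left modules that stays exact after applying
`E ⊗_R -` for each injective right module `E`. -/
def gorensteinFlat : ObjectProperty (ModuleCat.{u} R) := fun M =>
  ∃ (F : ℤ → ModuleCat.{u} R) (d : ∀ i : ℤ, F i →ₗ[R] F (i + 1)),
    (∀ i, IsFlat (F i)) ∧
    (∀ i, Function.Exact (d i) (d (i + 1))) ∧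
    (∀ E : ModuleCat.{u} Rᵐᵒᵖ, Module.Injective Rᵐᵒᵖ E → ∀ i,
      Function.Exact (BalancedTensor.map (LinearMap.id : E →ₗ[Rᵐᵒᵖ] E) (d i))
        (BalancedTensor.map (LinearMap.id : E →ₗ[Rᵐᵒᵖ] E) (d (i + 1)))) ∧
    Nonempty (M ≃ₗ[R] LinearMap.ker (d 0))

/-- The class `𝒢𝒞` of Gorenstein cotorsion left modules: all `C` with `Ext^1(G, C) = 0` for every
Gorenstein flat `G`. -/
def gorensteinCotorsion : ObjectProperty (ModuleCat.{u} R) :=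
  rightPerp (gorensteinFlat R)

end GorensteinFlat

end DingChen

/-! Write W⁺ for the character module of W. Since Ext^n(M, W⁺) is the character group of Tor_n(W,
M), Tor conditions can be handled as Ext conditions against duals. The theorem follows from two
facts about the classes `TorZero S`, where `S` is a class of right modules.

For every `S`, the class `TorZero S` is the left half of a complete hereditary cotorsion pair
(`isCompleteHereditaryCotorsionPair_torZero`). Duals are injective with respect to pure embeddings,
so `TorZero S` is closed under pure submodules and pure quotients. Every element lies in a pure
submodule of bounded size, so by Zorn's lemma Ext^1(-, C) vanishes on the class once it vanishes on
its small members (`TorZero.extZero_of_small`). The small object argument then gives special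
preenvelopes, and Salce's pushout gives special precovers.

Over a Ding-Chen ring the Gorenstein flat modules are exactly `TorZero (injectiveModules R)`. One
inclusion is dimension shifting along the complex. For the other, the left half of the complex is a
free resolution, and the right half needs M to embed in a flat module with cokernel again in the
class (`TorZero.exists_cosyzygy`). By right coherence, products of flat modules and duals of
injective right modules are flat. Hence M has a flat preenvelope, and extending maps M → E⁺ over it
shows that its cokernel is in the class, provided that it is injective, that is, provided that M
embeds in some flat module.

For that, embed M in an injective I. Finite FP-injective dimension of R as a right module bounds the
flat dimension of I. A special flat precover F → I then has a cotorsion kernel of finite flat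
dimension. Such a kernel is right orthogonal to M, because a flat cotorsion module is a summand of
its double dual, which is the dual of an injective (`extZero_of_cotorsion`). So M → I lifts to an
embedding M → F. -/

namespace DingChen

/-! ### Vanishing of Ext along short exact sequences in an abelian category -/

section AbelianExt

open Abelian

universe v w

variable {C : Type w} [Category.{v} C] [Abelian C] [HasExt.{v} C] {S : ShortComplex C}
  (hS : S.ShortExact) (N : C)

include hS

theorem ext_subsingleton_X₂ {n : ℕ} (h₁ : Subsingleton (Ext N S.X₁ n))
    (h₃ : Subsingleton (Ext N S.X₃ n)) : Subsingleton (Ext N S.X₂ n) := by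
  refine subsingleton_of_forall_eq 0 fun x => ?_
  obtain ⟨y, rfl⟩ := Ext.covariant_sequence_exact₂ _ hS x (Subsingleton.elim _ _)
  rw [Subsingleton.elim y 0, Ext.zero_comp]

theorem ext_subsingleton_X₃ {n : ℕ} (h₂ : Subsingleton (Ext N S.X₂ n))
    (h₁ : Subsingleton (Ext N S.X₁ (n + 1))) : Subsingleton (Ext N S.X₃ n) := by
  refine subsingleton_of_forall_eq 0 fun x => ?_
  obtain ⟨y, rfl⟩ := Ext.covariant_sequence_exact₃ _ hS x rfl (Subsingleton.elim _ _)
  rw [Subsingleton.elim y 0, Ext.zero_comp]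

theorem ext_subsingleton_X₁ {n : ℕ} (h₃ : Subsingleton (Ext N S.X₃ n))
    (h₂ : Subsingleton (Ext N S.X₂ (n + 1))) : Subsingleton (Ext N S.X₁ (n + 1)) := by
  refine subsingleton_of_forall_eq 0 fun x => ?_
  obtain ⟨y, rfl⟩ := Ext.covariant_sequence_exact₁ _ hS x (Subsingleton.elim _ _) rfl
  rw [Subsingleton.elim y 0, Ext.zero_comp]

theorem ext_subsingleton_X₂' {n : ℕ} (h₁ : Subsingleton (Ext S.X₁ N n))
    (h₃ : Subsingleton (Ext S.X₃ N n)) : Subsingleton (Ext S.X₂ N n) := by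
  refine subsingleton_of_forall_eq 0 fun x => ?_
  obtain ⟨y, rfl⟩ := Ext.contravariant_sequence_exact₂ hS _ x (Subsingleton.elim _ _)
  rw [Subsingleton.elim y 0, Ext.comp_zero]

theorem ext_subsingleton_X₁' {n : ℕ} (h₂ : Subsingleton (Ext S.X₂ N n))
    (h₃ : Subsingleton (Ext S.X₃ N (n + 1))) : Subsingleton (Ext S.X₁ N n) := by
  refine subsingleton_of_forall_eq 0 fun x => ?_
  obtain ⟨y, rfl⟩ := Ext.contravariant_sequence_exact₁ hS _ x (add_comm 1 n)
    (Subsingleton.elim _ _)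
  rw [Subsingleton.elim y 0, Ext.comp_zero]

theorem ext_subsingleton_X₃' {n : ℕ} (h₁ : Subsingleton (Ext S.X₁ N n))
    (h₂ : Subsingleton (Ext S.X₂ N (n + 1))) : Subsingleton (Ext S.X₃ N (n + 1)) := by
  refine subsingleton_of_forall_eq 0 fun x => ?_
  obtain ⟨y, rfl⟩ := Ext.contravariant_sequence_exact₃ hS _ x (Subsingleton.elim _ _)
    (add_comm 1 n)
  rw [Subsingleton.elim y 0, Ext.comp_zero]

theorem exists_extend_of_ext_one {N : C} (h₃ : Subsingleton (Ext S.X₃ N 1)) (f : S.X₁ ⟶ N) :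
    ∃ g : S.X₂ ⟶ N, S.f ≫ g = f := by
  obtain ⟨x, hx⟩ := Ext.contravariant_sequence_exact₁ hS N (Ext.mk₀ f) (add_zero 1)
    (Subsingleton.elim _ _)
  obtain ⟨g, rfl⟩ := (Ext.mk₀_bijective _ _).2 x
  rw [Ext.mk₀_comp_mk₀] at hx
  exact ⟨g, (Ext.mk₀_bijective _ _).1 hx⟩

theorem exists_lift_of_ext_one {N : C} (h₁ : Subsingleton (Ext N S.X₁ 1)) (f : N ⟶ S.X₃) :
    ∃ g : N ⟶ S.X₂, g ≫ S.g = f := by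
  obtain ⟨x, hx⟩ := Ext.covariant_sequence_exact₃ N hS (Ext.mk₀ f) (zero_add 1)
    (Subsingleton.elim _ _)
  obtain ⟨g, rfl⟩ := (Ext.mk₀_bijective _ _).2 x
  rw [Ext.mk₀_comp_mk₀] at hx
  exact ⟨g, (Ext.mk₀_bijective _ _).1 hx⟩

/-- As Ext^1 of the middle term vanishes, every class is the connecting image of some map f; if f
extends, its connecting image is zero. -/
theorem ext_one_of_exists_extend {N : C} (h₂ : Subsingleton (Ext S.X₂ N 1))
    (h : ∀ f : S.X₁ ⟶ N, ∃ g : S.X₂ ⟶ N, S.f ≫ g = f) : Subsingleton (Ext S.X₃ N 1) := by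
  refine subsingleton_of_forall_eq 0 fun x => ?_
  obtain ⟨y, rfl⟩ := Ext.contravariant_sequence_exact₃ hS _ x (Subsingleton.elim _ _)
    (add_zero 1)
  obtain ⟨f, rfl⟩ := (Ext.mk₀_bijective _ _).2 y
  obtain ⟨g, rfl⟩ := h f
  rw [← Ext.mk₀_comp_mk₀, hS.extClass_comp_assoc]

theorem ext_one_of_exists_lift {N : C} (h₂ : Subsingleton (Ext N S.X₂ 1))
    (h : ∀ f : N ⟶ S.X₃, ∃ g : N ⟶ S.X₂, g ≫ S.g = f) : Subsingleton (Ext N S.X₁ 1) := by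
  refine subsingleton_of_forall_eq 0 fun x => ?_
  obtain ⟨y, rfl⟩ := Ext.covariant_sequence_exact₁ _ hS x (Subsingleton.elim _ _)
    (zero_add 1)
  obtain ⟨f, rfl⟩ := (Ext.mk₀_bijective _ _).2 y
  obtain ⟨g, rfl⟩ := h f
  rw [← Ext.mk₀_comp_mk₀, Ext.comp_assoc_of_second_deg_zero, hS.comp_extClass, Ext.comp_zero]

end AbelianExt

/-! ### The same tools for unbundled modules -/

section ModuleExt

variable {R : Type u} [Ring R]

/-- `0 → X → Y → Z → 0` is a short exact sequence of modules. -/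
structure IsSES {X Y Z : Type u} [AddCommGroup X] [Module R X] [AddCommGroup Y] [Module R Y]
    [AddCommGroup Z] [Module R Z] (i : X →ₗ[R] Y) (p : Y →ₗ[R] Z) : Prop where
  inj : Function.Injective i
  exact : Function.Exact i p
  surj : Function.Surjective p

variable (R) in
/-- `Ext^n(M, N) = 0`. -/
def ExtZero (M N : Type u) [AddCommGroup M] [Module R M] [AddCommGroup N] [Module R N]
    (n : ℕ) : Prop :=
  Subsingleton (Abelian.Ext (ModuleCat.of R M) (ModuleCat.of R N) n)

namespace IsSES

variable {X Y Z : Type u} [AddCommGroup X] [Module R X] [AddCommGroup Y] [Module R Y]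
    [AddCommGroup Z] [Module R Z] {i : X →ₗ[R] Y} {p : Y →ₗ[R] Z}

theorem comp_eq_zero (h : IsSES i p) : p ∘ₗ i = 0 :=
  LinearMap.ext fun x => h.exact.apply_apply_eq_zero x

theorem of_injective (hi : Function.Injective i) : IsSES i (LinearMap.range i).mkQ :=
  ⟨hi, fun y => by simp [← LinearMap.mem_range], Submodule.mkQ_surjective _⟩

theorem of_surjective (hp : Function.Surjective p) : IsSES (LinearMap.ker p).subtype p :=
  ⟨Subtype.val_injective, fun y => by simp, hp⟩

theorem of_submodule (L : Submodule R Y) : IsSES L.subtype L.mkQ :=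
  ⟨L.injective_subtype, fun y => by simp, L.mkQ_surjective⟩

/-- The associated short complex. -/
def complex (h : IsSES i p) : ShortComplex (ModuleCat.{u} R) :=
  ShortComplex.mk (ModuleCat.ofHom i) (ModuleCat.ofHom p) (by
    rw [← ModuleCat.ofHom_comp, h.comp_eq_zero]; rfl)

theorem shortExact (h : IsSES i p) : h.complex.ShortExact where
  exact := (ShortComplex.ShortExact.moduleCat_exact_iff_function_exact h.complex).mpr h.exact
  mono_f := (ModuleCat.mono_iff_injective _).mpr h.inj
  epi_g := (ModuleCat.epi_iff_surjective _).mpr h.surj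

variable {N : Type u} [AddCommGroup N] [Module R N]

theorem ext_mid (h : IsSES i p) {n : ℕ} (hX : ExtZero R N X n) (hZ : ExtZero R N Z n) :
    ExtZero R N Y n :=
  ext_subsingleton_X₂ h.shortExact (ModuleCat.of R N) hX hZ

theorem ext_right (h : IsSES i p) {n : ℕ} (hY : ExtZero R N Y n) (hX : ExtZero R N X (n + 1)) :
    ExtZero R N Z n :=
  ext_subsingleton_X₃ h.shortExact (ModuleCat.of R N) hY hX

theorem ext_left (h : IsSES i p) {n : ℕ} (hZ : ExtZero R N Z n) (hY : ExtZero R N Y (n + 1)) :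
    ExtZero R N X (n + 1) :=
  ext_subsingleton_X₁ h.shortExact (ModuleCat.of R N) hZ hY

theorem ext_mid' (h : IsSES i p) {n : ℕ} (hX : ExtZero R X N n) (hZ : ExtZero R Z N n) :
    ExtZero R Y N n :=
  ext_subsingleton_X₂' h.shortExact (ModuleCat.of R N) hX hZ

theorem ext_left' (h : IsSES i p) {n : ℕ} (hY : ExtZero R Y N n) (hZ : ExtZero R Z N (n + 1)) :
    ExtZero R X N n :=
  ext_subsingleton_X₁' h.shortExact (ModuleCat.of R N) hY hZ

theorem ext_right' (h : IsSES i p) {n : ℕ} (hX : ExtZero R X N n)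
    (hY : ExtZero R Y N (n + 1)) : ExtZero R Z N (n + 1) :=
  ext_subsingleton_X₃' h.shortExact (ModuleCat.of R N) hX hY

theorem exists_extend (h : IsSES i p) (hZ : ExtZero R Z N 1) (f : X →ₗ[R] N) :
    ∃ g : Y →ₗ[R] N, g ∘ₗ i = f := by
  obtain ⟨g, hg⟩ := exists_extend_of_ext_one (N := ModuleCat.of R N) h.shortExact hZ
    (ModuleCat.ofHom f)
  exact ⟨g.hom, congrArg ModuleCat.Hom.hom hg⟩

theorem exists_lift (h : IsSES i p) (hX : ExtZero R N X 1) (f : N →ₗ[R] Z) :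
    ∃ g : N →ₗ[R] Y, p ∘ₗ g = f := by
  obtain ⟨g, hg⟩ := exists_lift_of_ext_one (N := ModuleCat.of R N) h.shortExact hX
    (ModuleCat.ofHom f)
  exact ⟨g.hom, congrArg ModuleCat.Hom.hom hg⟩

theorem ext_one_of_extend (h : IsSES i p) (hY : ExtZero R Y N 1)
    (H : ∀ f : X →ₗ[R] N, ∃ g : Y →ₗ[R] N, g ∘ₗ i = f) : ExtZero R Z N 1 := by
  refine ext_one_of_exists_extend (N := ModuleCat.of R N) h.shortExact hY fun f => ?_
  obtain ⟨g, hg⟩ := H f.hom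
  exact ⟨ModuleCat.ofHom g, ModuleCat.hom_ext hg⟩

theorem ext_one_of_lift (h : IsSES i p) (hY : ExtZero R N Y 1)
    (H : ∀ f : N →ₗ[R] Z, ∃ g : N →ₗ[R] Y, p ∘ₗ g = f) : ExtZero R N X 1 := by
  refine ext_one_of_exists_lift (N := ModuleCat.of R N) h.shortExact hY fun f => ?_
  obtain ⟨g, hg⟩ := H f.hom
  exact ⟨ModuleCat.ofHom g, ModuleCat.hom_ext hg⟩

end IsSES

variable {M M' N N' : Type u} [AddCommGroup M] [Module R M] [AddCommGroup M'] [Module R M']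
  [AddCommGroup N] [Module R N] [AddCommGroup N'] [Module R N']

theorem ExtZero.of_projective [Module.Projective R M] (n : ℕ) : ExtZero R M N (n + 1) :=
  Abelian.Ext.subsingleton_of_projective _ _ _

theorem ExtZero.of_injective (hN : Module.Injective R N) (n : ℕ) : ExtZero R M N (n + 1) :=
  have : Injective (ModuleCat.of R N) := Module.injective_object_of_injective_module R N
  Abelian.Ext.subsingleton_of_injective _ _ _

/-- Vanishing of `Ext` passes to direct summands of the first argument. -/
theorem ExtZero.of_retract_left {n : ℕ} (h : ExtZero R M N n) (i : M' →ₗ[R] M) (r : M →ₗ[R] M')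
    (hr : ∀ x, r (i x) = x) : ExtZero R M' N n := by
  unfold ExtZero at *
  refine subsingleton_of_forall_eq 0 fun x => ?_
  have hri : ModuleCat.ofHom i ≫ ModuleCat.ofHom r = 𝟙 (ModuleCat.of R M') :=
    ModuleCat.hom_ext (LinearMap.ext hr)
  rw [← Abelian.Ext.mk₀_id_comp x, ← hri, ← Abelian.Ext.mk₀_comp_mk₀_assoc,
    Subsingleton.elim ((Abelian.Ext.mk₀ (ModuleCat.ofHom r)).comp x (zero_add n)) 0,
    Abelian.Ext.comp_zero]

/-- Vanishing of `Ext` passes to direct summands of the second argument. -/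
theorem ExtZero.of_retract_right {n : ℕ} (h : ExtZero R M N n) (i : N' →ₗ[R] N)
    (r : N →ₗ[R] N') (hr : ∀ x, r (i x) = x) : ExtZero R M N' n := by
  unfold ExtZero at *
  refine subsingleton_of_forall_eq 0 fun x => ?_
  have hri : ModuleCat.ofHom i ≫ ModuleCat.ofHom r = 𝟙 (ModuleCat.of R N') :=
    ModuleCat.hom_ext (LinearMap.ext hr)
  rw [← Abelian.Ext.comp_mk₀_id x, ← hri, ← Abelian.Ext.mk₀_comp_mk₀,
    ← Abelian.Ext.comp_assoc_of_third_deg_zero,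
    Subsingleton.elim (x.comp (Abelian.Ext.mk₀ (ModuleCat.ofHom i)) (add_zero n)) 0,
    Abelian.Ext.zero_comp]

theorem ExtZero.congr_left {n : ℕ} (h : ExtZero R M N n) (e : M ≃ₗ[R] M') : ExtZero R M' N n :=
  h.of_retract_left e.symm.toLinearMap e.toLinearMap fun x => e.apply_symm_apply x

variable (R M) in
/-- Every module embeds into an injective module. -/
theorem exists_injective_embedding : ∃ (I : Type u) (_ : AddCommGroup I) (_ : Module R I)
    (i : M →ₗ[R] I), Module.Injective R I ∧ Function.Injective i := by
  obtain ⟨P⟩ := EnoughInjectives.presentation (ModuleCat.of R M)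
  exact ⟨P.J, inferInstance, inferInstance, P.f.hom,
    Module.injective_module_of_injective_object (inj := P.injective),
    (ModuleCat.mono_iff_injective _).mp P.mono⟩

end ModuleExt

/-! ### Characters with values in the circle ℝ/ℤ -/

section Characters

theorem exists_character_extension {A B : Type*} [AddCommGroup A] [AddCommGroup B] (f : A →+ B)
    (hf : Function.Injective f) (χ : A →+ UnitAddCircle) :
    ∃ ψ : B →+ UnitAddCircle, ∀ a, ψ (f a) = χ a := by
  obtain ⟨ψ, hψ⟩ := (Module.Baer.of_divisible UnitAddCircle).extension_property_addMonoidHom f hf χ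
  exact ⟨ψ, fun a => DFunLike.congr_fun hψ a⟩

/-- The inclusion of `ℚ/ℤ` into `ℝ/ℤ`. -/
noncomputable def ratCircleHom : AddCircle (1 : ℚ) →+ UnitAddCircle :=
  QuotientAddGroup.map _ _ (Rat.castHom ℝ).toAddMonoidHom (by
    rw [AddSubgroup.zmultiples_le]
    exact ⟨1, by simp⟩)

theorem ratCircleHom_injective : Function.Injective ratCircleHom := by
  rw [injective_iff_map_eq_zero]
  rintro ⟨q⟩ hq
  obtain ⟨n, hn⟩ := (QuotientAddGroup.eq_zero_iff _).mp hq
  refine (QuotientAddGroup.eq_zero_iff _).mpr ⟨n, ?_⟩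
  have : ((n : ℚ) : ℝ) = (q : ℝ) := by simpa using hn
  simpa using Rat.cast_injective this

/-- ℚ/ℤ already separates points, and it embeds in ℝ/ℤ. The circle is preferred because it is
compact Hausdorff, which provides the limits in `IsPure.exists_extend`. -/
theorem exists_character_ne_zero {A : Type*} [AddCommGroup A] {a : A} (ha : a ≠ 0) :
    ∃ χ : A →+ UnitAddCircle, χ a ≠ 0 := by
  obtain ⟨c, hc⟩ := CharacterModule.exists_character_apply_ne_zero_of_ne_zero ha
  exact ⟨ratCircleHom.comp c, fun h => hc (ratCircleHom_injective (h.trans (map_zero _).symm))⟩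

/-- Characters separate points from subgroups. -/
theorem mem_of_forall_character {A : Type*} [AddCommGroup A] {H : AddSubgroup A} {a : A}
    (h : ∀ χ : A →+ UnitAddCircle, (∀ x ∈ H, χ x = 0) → χ a = 0) : a ∈ H := by
  by_contra ha
  obtain ⟨χ, hχ⟩ := exists_character_ne_zero
    (a := (QuotientAddGroup.mk a : A ⧸ H)) (by rwa [Ne, QuotientAddGroup.eq_zero_iff])
  refine hχ (h (χ.comp (QuotientAddGroup.mk' H)) fun x hx => ?_)
  simp [(QuotientAddGroup.eq_zero_iff x).mpr hx]

/-- A character that vanishes on the kernel of `g` factors through `g`. -/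
theorem exists_character_factor {A B : Type*} [AddCommGroup A] [AddCommGroup B] (g : A →+ B)
    (χ : A →+ UnitAddCircle) (h : ∀ a, g a = 0 → χ a = 0) :
    ∃ ψ : B →+ UnitAddCircle, ∀ a, ψ (g a) = χ a := by
  obtain ⟨ψ, hψ⟩ := exists_character_extension (QuotientAddGroup.kerLift g)
    (QuotientAddGroup.kerLift_injective g) (QuotientAddGroup.lift g.ker χ h)
  exact ⟨ψ, fun a => hψ (QuotientAddGroup.mk a)⟩

/-- The circle is an injective cogenerator of abelian groups, so dualizing both preserves and
reflects exactness. -/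
theorem exact_iff_characters {A B C : Type*} [AddCommGroup A] [AddCommGroup B] [AddCommGroup C]
    (f : A →+ B) (g : B →+ C) : Function.Exact f g ↔ (∀ a, g (f a) = 0) ∧
      ∀ χ : B →+ UnitAddCircle, (∀ a, χ (f a) = 0) →
        ∃ ψ : C →+ UnitAddCircle, ∀ b, ψ (g b) = χ b := by
  constructor
  · refine fun h => ⟨h.apply_apply_eq_zero, fun χ hχ => exists_character_factor g χ fun b hb => ?_⟩
    obtain ⟨a, rfl⟩ := (h b).mp hb
    exact hχ a
  · rintro ⟨h0, h⟩ b
    refine ⟨fun hb => ?_, by rintro ⟨a, rfl⟩; exact h0 a⟩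
    refine (mem_of_forall_character (H := f.range) fun χ hχ => ?_ : b ∈ f.range)
    obtain ⟨ψ, hψ⟩ := h χ fun a => hχ _ ⟨a, rfl⟩
    rw [← hψ, hb, map_zero]

end Characters

/-! ### Character modules and their adjunction -/

section Duals

/-- The character group of a right module, as a left module. -/
def LDual (W : Type u) [AddCommGroup W] : Type u := W →+ UnitAddCircle

/-- The character group of a left module, as a right module. -/
def RDual (M : Type u) [AddCommGroup M] : Type u := M →+ UnitAddCircle

noncomputable instance (W : Type u) [AddCommGroup W] : AddCommGroup (LDual W) :=
  inferInstanceAs (AddCommGroup (W →+ UnitAddCircle))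

noncomputable instance (M : Type u) [AddCommGroup M] : AddCommGroup (RDual M) :=
  inferInstanceAs (AddCommGroup (M →+ UnitAddCircle))

instance (W : Type u) [AddCommGroup W] : FunLike (LDual W) W UnitAddCircle :=
  inferInstanceAs (FunLike (W →+ UnitAddCircle) W UnitAddCircle)

instance (W : Type u) [AddCommGroup W] : AddMonoidHomClass (LDual W) W UnitAddCircle :=
  inferInstanceAs (AddMonoidHomClass (W →+ UnitAddCircle) W UnitAddCircle)

instance (M : Type u) [AddCommGroup M] : FunLike (RDual M) M UnitAddCircle :=
  inferInstanceAs (FunLike (M →+ UnitAddCircle) M UnitAddCircle)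

instance (M : Type u) [AddCommGroup M] : AddMonoidHomClass (RDual M) M UnitAddCircle :=
  inferInstanceAs (AddMonoidHomClass (M →+ UnitAddCircle) M UnitAddCircle)

variable {R : Type u} [Ring R]

section basic

variable {W : Type u} [AddCommGroup W] {M : Type u} [AddCommGroup M]

@[ext] theorem LDual.ext {f g : LDual W} (h : ∀ w, f w = g w) : f = g := DFunLike.ext _ _ h

@[ext] theorem RDual.ext {f g : RDual M} (h : ∀ m, f m = g m) : f = g := DFunLike.ext _ _ h

@[simp] theorem LDual.add_apply (f g : LDual W) (w : W) : (f + g) w = f w + g w := rfl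

@[simp] theorem LDual.zero_apply (w : W) : (0 : LDual W) w = 0 := rfl

@[simp] theorem RDual.add_apply (f g : RDual M) (m : M) : (f + g) m = f m + g m := rfl

@[simp] theorem RDual.zero_apply (m : M) : (0 : RDual M) m = 0 := rfl

variable [Module Rᵐᵒᵖ W] [Module R M]

noncomputable instance : Module R (LDual W) where
  smul r f := AddMonoidHom.mk' (fun w => f (MulOpposite.op r • w)) fun _ _ => by
    rw [smul_add, map_add]
  one_smul f := LDual.ext fun w => congrArg f (one_smul Rᵐᵒᵖ w)
  mul_smul r s f := LDual.ext fun w => congrArg f (mul_smul (MulOpposite.op s) (MulOpposite.op r) w)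
  smul_zero _ := rfl
  smul_add _ _ _ := rfl
  add_smul r s f := LDual.ext fun w =>
    (congrArg f (add_smul (MulOpposite.op r) (MulOpposite.op s) w)).trans (map_add f _ _)
  zero_smul f := LDual.ext fun w => (congrArg f (zero_smul Rᵐᵒᵖ w)).trans (map_zero f)

noncomputable instance : Module Rᵐᵒᵖ (RDual M) where
  smul r f := AddMonoidHom.mk' (fun m => f (r.unop • m)) fun _ _ => by
    rw [smul_add, map_add]
  one_smul f := RDual.ext fun w => congrArg f (one_smul R w)
  mul_smul r s f := RDual.ext fun w => congrArg f (mul_smul s.unop r.unop w)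
  smul_zero _ := rfl
  smul_add _ _ _ := rfl
  add_smul r s f := RDual.ext fun w =>
    (congrArg f (add_smul r.unop s.unop w)).trans (map_add f _ _)
  zero_smul f := RDual.ext fun w => (congrArg f (zero_smul R w)).trans (map_zero f)

@[simp] theorem LDual.smul_apply (r : R) (f : LDual W) (w : W) :
    (r • f) w = f (MulOpposite.op r • w) := rfl

@[simp] theorem RDual.smul_apply (r : Rᵐᵒᵖ) (f : RDual M) (m : M) :
    (r • f) m = f (r.unop • m) := rfl

theorem LDual.sum_apply {ι : Type*} (s : Finset ι) (f : ι → LDual W) (w : W) :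
    (∑ i ∈ s, f i) w = ∑ i ∈ s, f i w :=
  map_sum (AddMonoidHom.mk' (fun g : LDual W => g w) fun _ _ => rfl) f s

theorem RDual.sum_apply {ι : Type*} (s : Finset ι) (f : ι → RDual M) (m : M) :
    (∑ i ∈ s, f i) m = ∑ i ∈ s, f i m :=
  map_sum (AddMonoidHom.mk' (fun g : RDual M => g m) fun _ _ => rfl) f s

/-- The adjunction between the two dualities, from left to right. -/
noncomputable def flipRight (f : M →ₗ[R] LDual W) : W →ₗ[Rᵐᵒᵖ] RDual M where
  toFun w := AddMonoidHom.mk' (fun m => f m w) fun a b => by rw [map_add]; rfl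
  map_add' a b := RDual.ext fun m => map_add (f m) a b
  map_smul' r w := RDual.ext fun m => by
    change f m (r • w) = f (r.unop • m) w
    rw [f.map_smul]; rfl

/-- The adjunction between the two dualities, from right to left. -/
noncomputable def flipLeft (f : W →ₗ[Rᵐᵒᵖ] RDual M) : M →ₗ[R] LDual W where
  toFun m := AddMonoidHom.mk' (fun w => f w m) fun a b => by rw [map_add]; rfl
  map_add' a b := LDual.ext fun w => map_add (f w) a b
  map_smul' r m := LDual.ext fun w => by
    change f w (r • m) = f (MulOpposite.op r • w) m
    rw [f.map_smul]; rfl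

@[simp] theorem flipRight_apply (f : M →ₗ[R] LDual W) (w : W) (m : M) :
    flipRight f w m = f m w := rfl

@[simp] theorem flipLeft_apply (f : W →ₗ[Rᵐᵒᵖ] RDual M) (w : W) (m : M) :
    flipLeft f m w = f w m := rfl

end basic

section map

variable {A B C : Type u} [AddCommGroup A] [AddCommGroup B] [AddCommGroup C]

/-- The contravariant action of `LDual` on homomorphisms. -/
noncomputable def LDual.map [Module Rᵐᵒᵖ A] [Module Rᵐᵒᵖ B] (g : A →ₗ[Rᵐᵒᵖ] B) : LDual B →ₗ[R] LDual A where
  toFun f := AddMonoidHom.mk' (fun a => f (g a)) fun a b => by rw [map_add, map_add]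
  map_add' _ _ := rfl
  map_smul' r f := LDual.ext fun a => congrArg f (map_smul g (MulOpposite.op r) a).symm

/-- The contravariant action of `RDual` on homomorphisms. -/
noncomputable def RDual.map [Module R A] [Module R B] (g : A →ₗ[R] B) : RDual B →ₗ[Rᵐᵒᵖ] RDual A where
  toFun f := AddMonoidHom.mk' (fun a => f (g a)) fun a b => by rw [map_add, map_add]
  map_add' _ _ := rfl
  map_smul' r f := RDual.ext fun a => congrArg f (map_smul g r.unop a).symm

@[simp] theorem LDual.map_apply [Module Rᵐᵒᵖ A] [Module Rᵐᵒᵖ B] (g : A →ₗ[Rᵐᵒᵖ] B) (f : LDual B)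
    (a : A) : LDual.map g f a = f (g a) := rfl

@[simp] theorem RDual.map_apply [Module R A] [Module R B] (g : A →ₗ[R] B) (f : RDual B)
    (a : A) : RDual.map g f a = f (g a) := rfl

theorem RDual.map_surjective [Module R A] [Module R B] {g : A →ₗ[R] B}
    (hg : Function.Injective g) : Function.Surjective (RDual.map g) := fun χ => by
  obtain ⟨ψ, hψ⟩ := exists_character_extension g.toAddMonoidHom hg χ
  exact ⟨ψ, RDual.ext hψ⟩

theorem IsSES.lDual [Module Rᵐᵒᵖ A] [Module Rᵐᵒᵖ B] [Module Rᵐᵒᵖ C] {i : A →ₗ[Rᵐᵒᵖ] B}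
    {p : B →ₗ[Rᵐᵒᵖ] C} (h : IsSES i p) : IsSES (LDual.map p) (LDual.map i) where
  inj f g hfg := LDual.ext fun c => by
    obtain ⟨b, rfl⟩ := h.surj c
    exact DFunLike.congr_fun hfg b
  exact f := by
    constructor
    · intro hf
      obtain ⟨ψ, hψ⟩ := exists_character_factor p.toAddMonoidHom f fun b hb => by
        obtain ⟨a, rfl⟩ := (h.exact b).mp hb
        exact DFunLike.congr_fun hf a
      exact ⟨ψ, LDual.ext hψ⟩
    · rintro ⟨ψ, rfl⟩
      exact LDual.ext fun a => by simp [h.exact.apply_apply_eq_zero]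
  surj χ := by
    obtain ⟨ψ, hψ⟩ := exists_character_extension i.toAddMonoidHom h.inj χ
    exact ⟨ψ, LDual.ext hψ⟩

/-- Extending X → A⁺ along an embedding X → Y is, by adjunction, lifting A → X⁺ through the
surjection Y⁺ → X⁺. -/
theorem LDual.injective_of_projective [Module Rᵐᵒᵖ A] [Module.Projective Rᵐᵒᵖ A] :
    Module.Injective R (LDual A) where
  out X Y _ _ _ _ f hf g := by
    obtain ⟨h, hh⟩ := Module.projective_lifting_property (RDual.map f) (flipRight g)
      (RDual.map_surjective hf)
    exact ⟨flipLeft h, fun x => LDual.ext fun a =>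
      DFunLike.congr_fun (DFunLike.congr_fun hh a) x⟩

end map

end Duals

/-! ### Tensor products through characters -/

section Tensor

variable {R : Type u} [Ring R] {E E' F F' : Type u}
    [AddCommGroup E] [Module Rᵐᵒᵖ E] [AddCommGroup E'] [Module Rᵐᵒᵖ E']
    [AddCommGroup F] [Module R F] [AddCommGroup F'] [Module R F']

/-- The class of the pure tensor `e ⊗ x`. -/
noncomputable def BalancedTensor.tmul (e : E) (x : F) : BalancedTensor R E F :=
  QuotientAddGroup.mk (TensorProduct.tmul ℤ e x)

theorem BalancedTensor.hom_ext {A : Type*} [AddCommGroup A] {f g : BalancedTensor R E F →+ A}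
    (h : ∀ e x, f (tmul e x) = g (tmul e x)) : f = g := by
  refine QuotientAddGroup.addMonoidHom_ext _ ?_
  refine AddMonoidHom.toIntLinearMap_injective (TensorProduct.ext' fun e x => h e x)

@[simp] theorem BalancedTensor.map_tmul (g : E →ₗ[Rᵐᵒᵖ] E') (f : F →ₗ[R] F') (e : E) (x : F) :
    BalancedTensor.map g f (tmul e x) = tmul (g e) (f x) := rfl

/-- The homomorphism to the dual that corresponds to a character of a tensor product. -/
noncomputable def homOfChar (χ : BalancedTensor R E F →+ UnitAddCircle) : F →ₗ[R] LDual E where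
  toFun x := AddMonoidHom.mk' (fun e => χ (BalancedTensor.tmul e x)) fun a b => by
    rw [← map_add]
    exact congrArg (fun t => χ (QuotientAddGroup.mk t)) (TensorProduct.add_tmul a b x)
  map_add' x y := LDual.ext fun e => by
    refine Eq.trans ?_ (map_add χ _ _)
    exact congrArg (fun t => χ (QuotientAddGroup.mk t)) (TensorProduct.tmul_add e x y)
  map_smul' r x := LDual.ext fun e => by
    refine congrArg χ ?_
    refine (QuotientAddGroup.eq.mpr ?_).symm
    rw [neg_add_eq_sub, ← neg_sub]
    exact neg_mem (AddSubgroup.subset_closure ⟨e, r, x, rfl⟩)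

@[simp] theorem homOfChar_apply (χ : BalancedTensor R E F →+ UnitAddCircle) (x : F) (e : E) :
    homOfChar χ x e = χ (BalancedTensor.tmul e x) := rfl

/-- The character of a tensor product that corresponds to a homomorphism to the dual. -/
noncomputable def charOfHom (f : F →ₗ[R] LDual E) : BalancedTensor R E F →+ UnitAddCircle :=
  QuotientAddGroup.lift _
    (TensorProduct.lift (LinearMap.mk₂ ℤ (fun (e : E) (x : F) => f x e)
      (fun a b x => map_add (f x) a b) (fun n a x => map_zsmul (f x) n a)
      (fun e x y => by rw [map_add]; rfl)
      (fun n e x => by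
        rw [map_zsmul]
        exact map_zsmul (AddMonoidHom.mk' (fun g : LDual E => g e) fun _ _ => rfl) n (f x)
        ))).toAddMonoidHom (by
    refine (AddSubgroup.closure_le _).mpr ?_
    rintro _ ⟨e, r, x, rfl⟩
    simp)

@[simp] theorem charOfHom_tmul (f : F →ₗ[R] LDual E) (e : E) (x : F) :
    charOfHom f (BalancedTensor.tmul e x) = f x e := rfl

/-- Injectivity of A ⊗ F → B ⊗ F means surjectivity on characters, and the characters of A ⊗ F are
the homomorphisms F → A⁺. -/
theorem isFlat_iff_forall_extend (F : ModuleCat.{u} R) : IsFlat F ↔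
    ∀ (A B : ModuleCat.{u} Rᵐᵒᵖ) (g : A →ₗ[Rᵐᵒᵖ] B), Function.Injective g →
      ∀ f : F →ₗ[R] LDual A, ∃ f' : F →ₗ[R] LDual B, LDual.map g ∘ₗ f' = f := by
  refine forall_congr' fun A => forall_congr' fun B => forall_congr' fun g =>
    imp_congr_right fun hg => ?_
  constructor
  · intro h f
    obtain ⟨ψ, hψ⟩ := exists_character_extension _ h (charOfHom f)
    refine ⟨homOfChar ψ, LinearMap.ext fun x => LDual.ext fun a => ?_⟩
    simpa using hψ (BalancedTensor.tmul a x)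
  · intro h
    rw [injective_iff_map_eq_zero]
    intro t ht
    by_contra ht0
    obtain ⟨χ, hχ⟩ := exists_character_ne_zero ht0
    obtain ⟨f', hf'⟩ := h (homOfChar χ)
    have : (charOfHom f').comp (BalancedTensor.map g (LinearMap.id : F →ₗ[R] F)) = χ :=
      BalancedTensor.hom_ext fun a x => by
        simpa using DFunLike.congr_fun (DFunLike.congr_fun hf' x) a
    refine hχ ?_
    rw [← this, AddMonoidHom.comp_apply, ht, map_zero]

/-- `E ⊗ F → E ⊗ F' → E ⊗ F''` is exact if and only if `Hom(-, E⁺)` is exact. -/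
theorem tensor_exact_iff {F'' : Type u} [AddCommGroup F''] [Module R F''] (f : F →ₗ[R] F')
    (g : F' →ₗ[R] F'') (hfg : g ∘ₗ f = 0) :
    Function.Exact (BalancedTensor.map (LinearMap.id : E →ₗ[Rᵐᵒᵖ] E) f)
      (BalancedTensor.map (LinearMap.id : E →ₗ[Rᵐᵒᵖ] E) g) ↔
    ∀ h : F' →ₗ[R] LDual E, h ∘ₗ f = 0 → ∃ k : F'' →ₗ[R] LDual E, k ∘ₗ g = h := by
  rw [exact_iff_characters]
  constructor
  · rintro ⟨-, H⟩ h hf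
    obtain ⟨ψ, hψ⟩ := H (charOfHom h) fun t => by
      have : (charOfHom h).comp (BalancedTensor.map (LinearMap.id : E →ₗ[Rᵐᵒᵖ] E) f) = 0 :=
        BalancedTensor.hom_ext fun e x => by
          simpa using DFunLike.congr_fun (DFunLike.congr_fun hf x) e
      exact DFunLike.congr_fun this t
    refine ⟨homOfChar ψ, LinearMap.ext fun x => LDual.ext fun e => ?_⟩
    simpa using hψ (BalancedTensor.tmul e x)
  · intro H
    constructor
    · intro t
      have : (BalancedTensor.map (LinearMap.id : E →ₗ[Rᵐᵒᵖ] E) g).comp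
          (BalancedTensor.map (LinearMap.id : E →ₗ[Rᵐᵒᵖ] E) f) = 0 :=
        BalancedTensor.hom_ext fun e x => by
          have h0 : g (f x) = 0 := DFunLike.congr_fun hfg x
          change BalancedTensor.tmul e (g (f x)) = 0
          rw [h0]
          exact congrArg QuotientAddGroup.mk (TensorProduct.tmul_zero F'' e)
      exact DFunLike.congr_fun this t
    · intro χ hχ
      obtain ⟨k, hk⟩ := H (homOfChar χ) (LinearMap.ext fun x => LDual.ext fun e => by
        simpa using hχ (BalancedTensor.tmul e x))
      have : (charOfHom k).comp (BalancedTensor.map (LinearMap.id : E →ₗ[Rᵐᵒᵖ] E) g) = χ :=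
        BalancedTensor.hom_ext fun e x => by
          simpa using DFunLike.congr_fun (DFunLike.congr_fun hk x) e
      exact ⟨charOfHom k, fun t => DFunLike.congr_fun this t⟩

end Tensor

/-! ### Pure submodules -/

section Purity

variable {R : Type u} [Ring R] {M : Type u} [AddCommGroup M] [Module R M]

/-- `N` is a pure submodule of `M`: a finite system of linear equations with constants in `N`
that is solvable in `M` is solvable in `N`. -/
def IsPure (N : Submodule R M) : Prop :=
  ∀ (m n : ℕ) (A : Fin m → Fin n → R) (c : Fin m → M), (∀ i, c i ∈ N) →
    (∃ x : Fin n → M, ∀ i, ∑ j, A i j • x j = c i) →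
    ∃ x : Fin n → M, (∀ j, x j ∈ N) ∧ ∀ i, ∑ j, A i j • x j = c i

theorem isPure_bot : IsPure (⊥ : Submodule R M) := fun m n A c hc _ =>
  ⟨0, fun _ => Submodule.zero_mem _, fun i => by simp [(Submodule.mem_bot R).mp (hc i)]⟩

theorem IsPure.of_directed {ι : Type*} [Nonempty ι] (N : ι → Submodule R M)
    (hN : Directed (· ≤ ·) N) (h : ∀ i, IsPure (N i)) : IsPure (⨆ i, N i) := by
  classical
  intro m n A c hc hx
  simp only [Submodule.mem_iSup_of_directed N hN] at hc
  choose k hk using hc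
  obtain ⟨l, hl⟩ := hN.finset_le (Finset.univ.image k)
  obtain ⟨x, hxN, hx⟩ := h l m n A c (fun i => hl (k i) (by simp) (hk i)) hx
  exact ⟨x, fun j => Submodule.mem_iSup_of_mem l (hxN j), hx⟩

/-- A solution modulo N with entries in L is lifted to M; it differs from a true solution by a
system with constants in N, and purity of N supplies a correction inside N. -/
theorem IsPure.comap_mkQ {N : Submodule R M} (hN : IsPure N) {L : Submodule R (M ⧸ N)}
    (hL : IsPure L) : IsPure (L.comap N.mkQ) := by
  rintro m n A c hc ⟨x, hx⟩
  obtain ⟨y, hyL, hy⟩ := hL m n A (fun i => N.mkQ (c i)) hc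
    ⟨fun j => N.mkQ (x j), fun i => by simp [← hx i]⟩
  choose y' hy' using fun j => N.mkQ_surjective (y j)
  obtain ⟨z, hzN, hz⟩ := hN m n A (fun i => ∑ j, A i j • (y' j - x j)) (fun i => by
      rw [← Submodule.Quotient.mk_eq_zero, ← Submodule.mkQ_apply]
      simp only [smul_sub, Finset.sum_sub_distrib, map_sub, map_sum, map_smul, hy', hy]
      rw [← hx i]
      simp) ⟨_, fun i => rfl⟩
  refine ⟨fun j => y' j - z j, fun j => ?_, fun i => ?_⟩
  · rw [Submodule.mem_comap, map_sub, hy', Submodule.mkQ_apply N (z j),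
      (Submodule.Quotient.mk_eq_zero N).mpr (hzN j), sub_zero]
    exact hyL j
  · simp only [smul_sub, Finset.sum_sub_distrib, hz, hx]
    abel

/-- A finite approximation to a retraction M → N. The elements of M occurring in `s` are the
unknowns and the values of the combinations the constants; the system is solved in M by these
elements themselves. -/
theorem IsPure.exists_retraction {N : Submodule R M} (hN : IsPure N) (s : Finset (M →₀ R))
    (hs : ∀ e ∈ s, Finsupp.linearCombination R id e ∈ N) :
    ∃ φ : M → N, ∀ e ∈ s, (Finsupp.linearCombination R φ e : M) =
      Finsupp.linearCombination R id e := by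
  classical
  set T : Finset M := s.biUnion Finsupp.support with hT
  obtain ⟨x, hxN, hx⟩ := hN s.card T.card
    (fun i j => (s.equivFin.symm i : M →₀ R) (T.equivFin.symm j))
    (fun i => Finsupp.linearCombination R id (s.equivFin.symm i : M →₀ R))
    (fun i => hs _ (s.equivFin.symm i).2) ⟨fun j => T.equivFin.symm j, fun i => by
      rw [Finsupp.linearCombination_apply, Finsupp.sum_of_support_subset (s := T) _
        (Finset.subset_biUnion_of_mem Finsupp.support (s.equivFin.symm i).2) _ (by simp),
        ← Finset.sum_coe_sort T, ← Equiv.sum_comp T.equivFin.symm]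
      rfl⟩
  refine ⟨fun m => if h : m ∈ T then ⟨x (T.equivFin ⟨m, h⟩), hxN _⟩ else 0, fun e he => ?_⟩
  have := hx (s.equivFin ⟨e, he⟩)
  rw [Equiv.symm_apply_apply] at this
  rw [← this, Finsupp.linearCombination_apply, Finsupp.sum_of_support_subset (s := T) _
        (Finset.subset_biUnion_of_mem Finsupp.support he) _ (by simp),
        ← Finset.sum_coe_sort, ← Equiv.sum_comp T.equivFin.symm]
  simp

/-- Character modules are injective with respect to pure embeddings. -/
theorem IsPure.exists_extend {N : Submodule R M} (hN : IsPure N) {W : Type u} [AddCommGroup W]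
    [Module Rᵐᵒᵖ W] (f : N →ₗ[R] LDual W) : ∃ g : M →ₗ[R] LDual W, g ∘ₗ N.subtype = f := by
  classical
  -- Combinations of value zero encode additivity and R-linearity, and single elements of N encode
  -- being the identity on N.
  let ι := Finset {e : M →₀ R // Finsupp.linearCombination R id e ∈ N}
  choose φ hφ using fun s : ι => hN.exists_retraction (s.map (Function.Embedding.subtype _))
    (fun e he => by
      obtain ⟨e, -, rfl⟩ := Finset.mem_map.mp he
      exact e.2)
  -- The maps f ∘ `φ s` satisfy more and more of these identities. Their pointwise limit along `U`
  -- exists by compactness of the circle and satisfies all of them.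
  let U : Ultrafilter ι := Ultrafilter.of Filter.atTop
  have hU : ∀ e : M →₀ R, Finsupp.linearCombination R id e ∈ N →
      ∀ᶠ s in (U : Filter ι), (Finsupp.linearCombination R (φ s) e : M) =
        Finsupp.linearCombination R id e := fun e he =>
    (Ultrafilter.of_le _) <| (Filter.eventually_ge_atTop {⟨e, he⟩}).mono fun s hs =>
      hφ s e (Finset.mem_map.mpr ⟨⟨e, he⟩, hs (Finset.mem_singleton_self _), rfl⟩)
  have hlim : ∀ m w, ∃ c : UnitAddCircle, Filter.Tendsto (fun s => f (φ s m) w) U (nhds c) :=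
    fun m w => ⟨_, (U.map fun s => f (φ s m) w).le_nhds_lim⟩
  choose g hg using hlim
  have key : ∀ m c w, (∀ᶠ s in (U : Filter ι), f (φ s m) w = c) → g m w = c := fun m c w h =>
    tendsto_nhds_unique (hg m w) (tendsto_const_nhds.congr' (h.mono fun _ hs => hs.symm))
  let G : M → LDual W := fun m => AddMonoidHom.mk' (g m) fun a b =>
    tendsto_nhds_unique (hg m (a + b)) (by simpa using (hg m a).add (hg m b))
  refine ⟨⟨⟨G, fun x y => LDual.ext fun w => ?_⟩, fun r x => LDual.ext fun w => ?_⟩,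
    LinearMap.ext fun n => LDual.ext fun w => ?_⟩
  · refine tendsto_nhds_unique (hg (x + y) w) (((hg x w).add (hg y w)).congr' ?_)
    have hmem : Finsupp.linearCombination R id (Finsupp.single (x + y) (1 : R) -
        Finsupp.single x 1 - Finsupp.single y 1) = 0 := by simp
    refine (hU _ (hmem ▸ N.zero_mem)).mono fun s hs => ?_
    rw [hmem] at hs
    have : φ s (x + y) = φ s x + φ s y := by
      have h2 := Subtype.ext (a2 := (0 : N)) hs
      simp only [map_sub, Finsupp.linearCombination_single, one_smul] at h2
      rw [← sub_eq_zero, ← h2]; abel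
    change _ = f (φ s (x + y)) w
    rw [this, map_add, LDual.add_apply]
  · refine tendsto_nhds_unique (hg (r • x) w) ((hg x (MulOpposite.op r • w)).congr' ?_)
    have hmem : Finsupp.linearCombination R id (Finsupp.single (r • x) (1 : R) -
        Finsupp.single x r) = 0 := by simp
    refine (hU _ (hmem ▸ N.zero_mem)).mono fun s hs => ?_
    rw [hmem] at hs
    have : φ s (r • x) = r • φ s x := by
      have h2 := Subtype.ext (a2 := (0 : N)) hs
      simp only [map_sub, Finsupp.linearCombination_single, one_smul] at h2
      rwa [← sub_eq_zero]
    change _ = f (φ s (r • x)) w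
    rw [this, f.map_smul, LDual.smul_apply]
  · refine key _ _ _ ((hU (Finsupp.single (n : M) 1) (by simp)).mono fun s hs => ?_)
    have : φ s n = n := Subtype.ext (by simpa using hs)
    rw [Submodule.subtype_apply, this]

variable (R) in
/-- Formal expressions built from variables, the module operations, and chosen solutions of
finite linear systems. -/
inductive PureTerm (V : Type u) : Type u
  | var (v : V) : PureTerm V
  | zero : PureTerm V
  | add (a b : PureTerm V) : PureTerm V
  | smul (r : R) (a : PureTerm V) : PureTerm V
  | sol (m n : ℕ) (A : Fin m → Fin n → R) (c : Fin m → PureTerm V) (j : Fin n) : PureTerm V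

open Classical in
/-- The value of a formal expression. -/
noncomputable def PureTerm.eval {V : Type u} (f : V → M) : PureTerm R V → M
  | var v => f v
  | zero => 0
  | add a b => a.eval f + b.eval f
  | smul r a => r • a.eval f
  | sol _ n A c j =>
      if h : ∃ x : Fin n → M, ∀ i, ∑ j, A i j • x j = (c i).eval f then h.choose j else 0

/-- Every family of elements is contained in a pure submodule of bounded size. -/
theorem exists_isPure {V : Type u} (f : V → M) : ∃ N : Submodule R M, IsPure N ∧
    (∀ v, f v ∈ N) ∧ ∃ p : (PureTerm R V →₀ R) →ₗ[R] N, Function.Surjective p := by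
  -- Closure under `sol` makes N pure. The type of terms depends only on R and V, so the free module
  -- mapping onto N is fixed before M is known.
  let N : Submodule R M :=
    { carrier := Set.range (PureTerm.eval (R := R) f)
      add_mem' := by
        rintro _ _ ⟨a, rfl⟩ ⟨b, rfl⟩
        exact ⟨.add a b, rfl⟩
      zero_mem' := ⟨.zero, rfl⟩
      smul_mem' := by
        rintro r _ ⟨a, rfl⟩
        exact ⟨.smul r a, rfl⟩ }
  refine ⟨N, ?_, fun v => ⟨.var v, rfl⟩,
    Finsupp.linearCombination R fun t => (⟨t.eval f, t, rfl⟩ : N), ?_⟩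
  · intro m n A c hc hx
    choose t ht using hc
    obtain rfl : (fun i => (t i).eval f) = c := funext ht
    refine ⟨fun j => (PureTerm.sol m n A t j).eval f, fun j => ⟨_, rfl⟩, fun i => ?_⟩
    simp only [PureTerm.eval, dif_pos hx]
    exact hx.choose_spec i
  · rintro ⟨_, t, rfl⟩
    exact ⟨Finsupp.single t 1, by simp⟩

end Purity

/-! ### Classes defined by vanishing of Tor -/

section TorClasses

variable {R : Type u} [Ring R] (S : ObjectProperty (ModuleCat.{u} Rᵐᵒᵖ))

/-- The modules `M` with `Tor_n(W, M) = 0` for all `W` in `S` and `n ≥ 1`, this condition being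
expressed by the vanishing of `Ext^n(M, W⁺)`. -/
def TorZero (M : Type u) [AddCommGroup M] [Module R M] : Prop :=
  ∀ W : ModuleCat.{u} Rᵐᵒᵖ, S W → ∀ n : ℕ, ExtZero R M (LDual W) (n + 1)

variable {S} {M X Y Z : Type u} [AddCommGroup M] [Module R M] [AddCommGroup X] [Module R X]
  [AddCommGroup Y] [Module R Y] [AddCommGroup Z] [Module R Z]

theorem TorZero.of_projective [Module.Projective R M] : TorZero S M :=
  fun _ _ n => ExtZero.of_projective n

theorem TorZero.congr (h : TorZero S X) (e : X ≃ₗ[R] Y) : TorZero S Y :=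
  fun W hW n => (h W hW n).congr_left e

theorem IsSES.torZero_left {i : X →ₗ[R] Y} {p : Y →ₗ[R] Z} (h : IsSES i p) (hY : TorZero S Y)
    (hZ : TorZero S Z) : TorZero S X :=
  fun W hW n => h.ext_left' (hY W hW n) (hZ W hW (n + 1))

theorem IsSES.torZero_mid {i : X →ₗ[R] Y} {p : Y →ₗ[R] Z} (h : IsSES i p) (hX : TorZero S X)
    (hZ : TorZero S Z) : TorZero S Y :=
  fun W hW n => h.ext_mid' (hX W hW n) (hZ W hW n)

variable (R) in
/-- Every module has a free presentation. -/
theorem isSES_free (M : Type u) [AddCommGroup M] [Module R M] :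
    IsSES (X := LinearMap.ker (Finsupp.linearCombination R (id : M → M))) (Y := M →₀ R)
      (LinearMap.ker (Finsupp.linearCombination R (id : M → M))).subtype
      (Finsupp.linearCombination R (id : M → M)) :=
  IsSES.of_surjective fun m => ⟨Finsupp.single m 1, by simp⟩

/-- Degree one is the extension property of duals. Higher degrees shift to the dual of a syzygy of
W, since duals of free modules are injective; hence W varies in the induction. -/
theorem IsPure.extZero_quotient {N : Submodule R M} (hN : IsPure N) (n : ℕ) :
    ∀ (W : Type u) [AddCommGroup W] [Module Rᵐᵒᵖ W],
      (∀ j : ℕ, ExtZero R M (LDual W) (j + 1)) → ExtZero R (M ⧸ N) (LDual W) (n + 1) := by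
  have hs := IsSES.of_submodule N
  induction n with
  | zero => exact fun W _ _ h => hs.ext_one_of_extend (h 0) hN.exists_extend
  | succ n ih =>
    intro W _ _ h
    have hd := (isSES_free Rᵐᵒᵖ W).lDual (R := R)
    have hinj := LDual.injective_of_projective (R := R) (A := W →₀ Rᵐᵒᵖ)
    refine hd.ext_left (ih _ fun j => ?_) (ExtZero.of_injective hinj _)
    exact hd.ext_right (ExtZero.of_injective hinj _) (h (j + 1))

theorem TorZero.quotient {N : Submodule R M} (h : TorZero S M) (hN : IsPure N) :
    TorZero S (M ⧸ N) :=
  fun W hW n => hN.extZero_quotient n W (h W hW)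

theorem TorZero.submodule {N : Submodule R M} (h : TorZero S M) (hN : IsPure N) : TorZero S N :=
  (IsSES.of_submodule N).torZero_left h (h.quotient hN)

/-- `Ext^1(-, C)` vanishes on a class of the form `TorZero S` as soon as it vanishes on its
members of bounded size. -/
theorem TorZero.extZero_of_small {C : Type u} [AddCommGroup C] [Module R C]
    (hC : ∀ (Y : Type u) [AddCommGroup Y] [Module R Y], TorZero S Y →
      ∀ p : (PureTerm R PUnit.{u + 1} →₀ R) →ₗ[R] Y, Function.Surjective p → ExtZero R Y C 1)
    (h : TorZero S M) : ExtZero R M C 1 := by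
  have hses := isSES_free R M
  set π := Finsupp.linearCombination R (id : M → M) with hπ
  refine hses.ext_one_of_extend (ExtZero.of_projective 0) fun g => ?_
  let p₀ : (M →₀ R) →ₗ.[R] C := ⟨LinearMap.ker π, g⟩
  -- Zorn's lemma on partial extensions of g whose domain has pure image in M; purity keeps both the
  -- image and its quotient in `TorZero S`.
  obtain ⟨p, hp0, ⟨hp1, hp2⟩, hmax⟩ := zorn_le_nonempty₀
    {p : (M →₀ R) →ₗ.[R] C | p₀ ≤ p ∧ IsPure (p.domain.map π)} (fun c hc hchain y hy => by
      have hdir : DirectedOn (· ≤ ·) c := hchain.directedOn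
      refine ⟨LinearPMap.sSup c hdir, ⟨(hc hy).1.trans (LinearPMap.le_sSup hdir hy), ?_⟩,
        fun z hz => LinearPMap.le_sSup hdir hz⟩
      have hne : Nonempty c := ⟨⟨y, hy⟩⟩
      have : (LinearPMap.sSup c hdir).domain.map π = ⨆ z : c, (z.1.domain.map π) := by
        rw [LinearPMap.domain_sSup, sSup_image, iSup_subtype', Submodule.map_iSup]
      rw [this]
      refine IsPure.of_directed _ (fun a b => ?_) fun z => (hc z.2).2
      obtain ⟨d, hd, had, hbd⟩ := hdir a a.2 b b.2
      exact ⟨⟨d, hd⟩, Submodule.map_mono had.1, Submodule.map_mono hbd.1⟩)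
    p₀ ⟨le_rfl, by
      have : (p₀.domain.map π) = ⊥ := by
        rw [eq_bot_iff]
        rintro _ ⟨x, hx, rfl⟩
        exact hx
      rw [this]
      exact isPure_bot⟩
  set N := p.domain.map π with hN
  have hdom : ∀ x, π x ∈ N ↔ x ∈ p.domain := fun x => by
    refine ⟨?_, fun hx => ⟨x, hx, rfl⟩⟩
    rintro ⟨y, hy, hxy⟩
    have : x - y ∈ LinearMap.ker π := by simp [hxy]
    simpa using p.domain.add_mem (hp1.1 this) hy
  have htop : N = ⊤ := by
    by_contra hne
    obtain ⟨m, hm⟩ : ∃ m, m ∉ N := by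
      by_contra! hall
      exact hne (eq_top_iff.mpr fun m _ => hall m)
    -- A small pure submodule of M/N containing the missing element. Its preimage D satisfies D /
    -- `p.domain` ≅ Y, so vanishing of Ext^1(Y, C) extends `p` to D, against maximality.
    obtain ⟨Y, hY, hmY, q, hq⟩ := exists_isPure (R := R) fun _ : PUnit.{u + 1} => N.mkQ m
    let D := (Y.comap N.mkQ).comap π
    have hle : p.domain ≤ D := fun x hx => by
      have : N.mkQ (π x) = 0 := by simpa using (hdom x).mpr hx
      change N.mkQ (π x) ∈ Y
      rw [this]; exact Y.zero_mem
    let r : D →ₗ[R] Y := (N.mkQ ∘ₗ π).restrict fun x hx => hx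
    have hr : IsSES (X := p.domain) (Y := D) (Z := Y) (Submodule.inclusion hle) r := by
      refine ⟨Submodule.inclusion_injective hle, fun x => ?_, fun y => ?_⟩
      · have : r x = 0 ↔ (x : M →₀ R) ∈ p.domain := by
          rw [← hdom, ← Submodule.Quotient.mk_eq_zero, ← Submodule.mkQ_apply, Subtype.ext_iff]
          rfl
        rw [this]
        exact ⟨fun hx => ⟨⟨x, hx⟩, rfl⟩, by rintro ⟨y, rfl⟩; exact y.2⟩
      · obtain ⟨z, hz⟩ := N.mkQ_surjective y
        obtain ⟨x, rfl⟩ := hses.surj z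
        exact ⟨⟨x, by change N.mkQ (π x) ∈ Y; rw [hz]; exact y.2⟩, Subtype.ext hz⟩
    obtain ⟨f, hf⟩ := hr.exists_extend (hC Y ((h.quotient hp2).submodule hY) q hq) p.toFun
    have hple : p ≤ ⟨D, f⟩ := ⟨hle, fun {x y} hxy => by
      have : y = Submodule.inclusion hle x := Subtype.ext hxy.symm
      rw [this]
      exact (DFunLike.congr_fun hf x).symm⟩
    have hD : D.map π = Y.comap N.mkQ :=
      Submodule.map_comap_eq_of_surjective hses.surj _
    have hDle := hmax (y := ⟨D, f⟩) ⟨hp1.trans hple, by rw [hD]; exact hp2.comap_mkQ hY⟩ hple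
    obtain ⟨x, hx⟩ := hses.surj m
    have hxD : x ∈ D := by
      change N.mkQ (π x) ∈ Y
      rw [hx]; exact hmY PUnit.unit
    exact hm (hx ▸ (hdom x).mpr (hDle.1 hxD))
  have htop' : p.domain = ⊤ := eq_top_iff.mpr fun x _ => (hdom x).mp (htop ▸ Submodule.mem_top)
  refine ⟨p.toFun ∘ₗ (LinearMap.id.codRestrict p.domain fun x => htop' ▸ Submodule.mem_top),
    LinearMap.ext fun x => ?_⟩
  exact (hp1.2 (x := x) rfl).symm

end TorClasses

/-! ### The small object argument -/

section Completeness

open Limits MorphismProperty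

variable {R : Type u} [Ring R]

/-- A small family of monomorphisms whose sources embed into a fixed object permits the small
object argument. -/
theorem hasSmallObjectArgument_of_mono {C : Type*} [Category.{u} C] [Abelian C]
    [IsGrothendieckAbelian.{u} C] (I : MorphismProperty C) [IsSmall.{u} I]
    (hI : I ≤ monomorphisms C) (G : C)
    (hG : ∀ ⦃A B : C⦄ (i : A ⟶ B), I i → ∃ j : A ⟶ G, Mono j) :
    HasSmallObjectArgument.{u} I := by
  -- A source embedded in G has fewer than κ subobjects, so maps out of it commute with the κ-long
  -- colimits of monomorphisms that arise below.
  obtain ⟨κ, hκ', hκ⟩ := HasCardinalLT.exists_regular_cardinal.{u} (Subobject G)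
  have : Fact κ.IsRegular := ⟨hκ'⟩
  have : Nonempty κ.ord.ToType := by simpa using hκ'.ne_zero
  have := WellFoundedLT.toOrderBot κ.ord.ToType
  exact ⟨κ, inferInstance, inferInstance,
    { preservesColimit {A B X Y} i hi f hf := by
        let hf' : (monomorphisms C).TransfiniteCompositionOfShape κ.ord.ToType f :=
          { toTransfiniteCompositionOfShape := hf.toTransfiniteCompositionOfShape
            map_mem j hj := by
              have := (hf.attachCells j hj).pushouts_coproducts
              simp only [ofHoms_homFamily] at this
              refine (?_ : _ ≤ monomorphisms C) _ this
              simp only [pushouts_le_iff, coproducts_le_iff]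
              exact hI }
        have (j j' : κ.ord.ToType) (φ : j ⟶ j') : Mono (hf'.F.map φ) := hf'.mem_map φ
        apply IsGrothendieckAbelian.preservesColimit_coyoneda_obj_of_mono (Y := hf'.F) (κ := κ)
        obtain ⟨j, hj⟩ := hG i hi
        exact Subobject.hasCardinalLT_of_mono hκ j }⟩

variable (S : ObjectProperty (ModuleCat.{u} Rᵐᵒᵖ))

/-- The right orthogonal of a class of the form `TorZero S`. -/
def TorPerp (C : Type u) [AddCommGroup C] [Module R C] : Prop :=
  ∀ (X : Type u) [AddCommGroup X] [Module R X], TorZero S X → ExtZero R X C 1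

/-- The inclusions of submodules of a fixed free module with quotient in `TorZero S`. -/
def generatingInclusions : MorphismProperty (ModuleCat.{u} R) :=
  ofHoms fun K : {K : Submodule R (PureTerm R PUnit.{u + 1} →₀ R) //
    TorZero S ((PureTerm R PUnit.{u + 1} →₀ R) ⧸ K)} =>
    ModuleCat.ofHom (X := K.1) (Y := PureTerm R PUnit.{u + 1} →₀ R) K.1.subtype

instance : HasSmallObjectArgument.{u} (generatingInclusions (R := R) S) := by
  have : IsSmall.{u} (generatingInclusions (R := R) S) := by
    dsimp [generatingInclusions]; infer_instance
  have hmono : generatingInclusions (R := R) S ≤ monomorphisms _ := by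
    rintro _ _ _ ⟨K⟩
    exact (ModuleCat.mono_iff_injective _).mpr Subtype.val_injective
  refine hasSmallObjectArgument_of_mono _ hmono
    (ModuleCat.of R (PureTerm R PUnit.{u + 1} →₀ R)) ?_
  rintro _ _ _ ⟨K⟩
  exact ⟨ModuleCat.ofHom (X := K.1) (Y := PureTerm R PUnit.{u + 1} →₀ R) K.1.subtype,
    (ModuleCat.mono_iff_injective _).mpr Subtype.val_injective⟩

variable {S}

/-- Degree one suffices: the W⁺ with W in S are orthogonal to `TorZero S` in all positive degrees,
their cosyzygies inherit this, and dimension shifting brings each degree back to one. -/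
theorem torZero_of_extZero_one {F : Type u} [AddCommGroup F] [Module R F]
    (hF : ∀ (B : Type u) [AddCommGroup B] [Module R B], TorPerp S B → ExtZero R F B 1) :
    TorZero S F := by
  have key : ∀ (n : ℕ) (Y : Type u) [AddCommGroup Y] [Module R Y],
      (∀ (X : Type u) [AddCommGroup X] [Module R X], TorZero S X →
        ∀ j : ℕ, ExtZero R X Y (j + 1)) → ExtZero R F Y (n + 1) := by
    intro n
    induction n with
    | zero => exact fun Y _ _ hY => hF Y fun X _ _ hX => hY X hX 0
    | succ n ih =>
      intro Y _ _ hY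
      obtain ⟨J, _, _, i, hJ, hi⟩ := exists_injective_embedding R Y
      have hs := IsSES.of_injective hi
      refine hs.ext_left (ih _ fun X _ _ hX j => ?_) (ExtZero.of_injective hJ _)
      exact hs.ext_right (ExtZero.of_injective hJ _) (hY X hX (j + 1))
  exact fun W hW n => key n (LDual W) fun X _ _ hX j => hX W hW j

variable (S) in
/-- Special `TorPerp S`-preenvelopes exist. -/
theorem exists_special_preenvelope (M : Type u) [AddCommGroup M] [Module R M] :
    ∃ (C : Type u) (_ : AddCommGroup C) (_ : Module R C) (G : Type u) (_ : AddCommGroup G)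
      (_ : Module R G) (i : M →ₗ[R] C) (p : C →ₗ[R] G),
      IsSES i p ∧ TorPerp S C ∧ TorZero S G := by
  let I := generatingInclusions (R := R) S
  -- M → 0 is factored. The lifting property of Z → 0 says that maps K → Z extend to the free
  -- module, which is orthogonality of Z to the small members of the class.
  let f : ModuleCat.of R M ⟶ ModuleCat.of R PUnit.{u + 1} := 0
  let fac := factorizationData I.rlp.llp I.rlp f
  have hlift : ∀ (K : Submodule R (PureTerm R PUnit.{u + 1} →₀ R))
      (_ : TorZero S ((PureTerm R PUnit.{u + 1} →₀ R) ⧸ K)) (g : K →ₗ[R] fac.Z),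
      ∃ g' : (PureTerm R PUnit.{u + 1} →₀ R) →ₗ[R] fac.Z, g' ∘ₗ K.subtype = g := by
    intro K hK g
    have hIK : I (ModuleCat.ofHom (X := K) (Y := PureTerm R PUnit.{u + 1} →₀ R) K.subtype) :=
      ofHoms.mk (ι := {K : Submodule R (PureTerm R PUnit.{u + 1} →₀ R) //
        TorZero S ((PureTerm R PUnit.{u + 1} →₀ R) ⧸ K)}) ⟨K, hK⟩
    have := fac.hp _ hIK
    have sq : CommSq (ModuleCat.ofHom g) (ModuleCat.ofHom (X := K) (Y := PureTerm R PUnit.{u + 1} →₀ R) K.subtype) fac.p 0 :=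
      ⟨ModuleCat.hom_ext (LinearMap.ext fun _ => Subsingleton.elim (α := PUnit.{u + 1}) _ _)⟩
    exact ⟨sq.lift.hom, congrArg ModuleCat.Hom.hom sq.fac_left⟩
  have hC : TorPerp S fac.Z := fun X _ _ hX => hX.extZero_of_small fun Y _ _ hY p hp => by
    have hs := IsSES.of_surjective hp
    exact hs.ext_one_of_extend (ExtZero.of_projective 0)
      (hlift _ (hY.congr (p.quotKerEquivOfSurjective hp).symm))
  have hmono : Function.Injective fac.i.hom := by
    -- J → 0 has the right lifting property by injectivity of J, so the embedding `j` factors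
    -- through `fac.i`.
    obtain ⟨J, _, _, j, hJ, hj⟩ := exists_injective_embedding R M
    have hrlp : I.rlp (0 : ModuleCat.of R J ⟶ ModuleCat.of R PUnit.{u + 1}) := by
      rintro _ _ _ ⟨K⟩
      refine ⟨fun {a b} sq => ?_⟩
      obtain ⟨l, hl⟩ := hJ.out K.1.subtype Subtype.val_injective a.hom
      exact ⟨⟨ModuleCat.ofHom l, ModuleCat.hom_ext (LinearMap.ext hl), ModuleCat.hom_ext
        (LinearMap.ext fun _ => Subsingleton.elim (α := PUnit.{u + 1}) _ _)⟩⟩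
    have := fac.hi _ hrlp
    have sq : CommSq (ModuleCat.ofHom j) fac.i (0 : ModuleCat.of R J ⟶ ModuleCat.of R PUnit.{u + 1})
        0 := ⟨by rw [Limits.comp_zero, Limits.comp_zero]⟩
    have hfac := congrArg ModuleCat.Hom.hom sq.fac_left
    have hinj : Function.Injective (sq.lift.hom ∘ₗ fac.i.hom) := by
      rw [← ModuleCat.hom_comp, hfac]; exact hj
    exact Function.Injective.of_comp hinj
  have hs := IsSES.of_injective hmono
  refine ⟨fac.Z, inferInstance, inferInstance, _, inferInstance, inferInstance, fac.i.hom, _, hs,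
    hC, torZero_of_extZero_one fun B _ _ hB => ?_⟩
  obtain ⟨J, _, _, j, hJ, hj⟩ := exists_injective_embedding R B
  have hsB := IsSES.of_injective hj
  refine hsB.ext_one_of_lift (ExtZero.of_injective hJ 0) fun φ => ?_
  set π := (LinearMap.range j).mkQ
  -- J → J/B has the right lifting property: lift from the free module by projectivity, then correct
  -- by a map K → B, which extends because B is orthogonal to the quotient by K. Lifting `fac.i`
  -- against it, with zero on M, lifts maps from the cokernel to J.
  have hrlp : I.rlp (ModuleCat.ofHom π) := by
    rintro _ _ _ ⟨K⟩
    refine ⟨fun {a b} sq => ?_⟩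
    obtain ⟨l, hl⟩ := Module.projective_lifting_property π b.hom hsB.surj
    have hK := IsSES.of_injective (X := K.1) (Y := PureTerm R PUnit.{u + 1} →₀ R)
      (i := K.1.subtype) K.1.injective_subtype
    have hab : ∀ k : K.1, π (a.hom k) = b.hom k.1 := fun k =>
      LinearMap.congr_fun (congrArg ModuleCat.Hom.hom sq.w) k
    have hdiff : ∀ k : K.1, (a.hom - l ∘ₗ K.1.subtype) k ∈ LinearMap.range j := fun k =>
      (hsB.exact _).mp (by
        have := LinearMap.congr_fun hl k.1
        simp only [LinearMap.comp_apply] at this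
        simp [hab, this])
    let e := LinearEquiv.ofInjective j hj
    obtain ⟨d, hd⟩ := hK.exists_extend (N := B)
      (hB _ (K.2.congr (Submodule.quotEquivOfEq _ _ K.1.range_subtype.symm)))
      (e.symm.toLinearMap ∘ₗ (a.hom - l ∘ₗ K.1.subtype).codRestrict _ hdiff)
    refine ⟨⟨ModuleCat.ofHom (l + j ∘ₗ d), ModuleCat.hom_ext (LinearMap.ext fun k => ?_),
      ModuleCat.hom_ext (LinearMap.ext fun x => ?_)⟩⟩
    · have h1 := congrArg j (LinearMap.congr_fun hd k)
      have h2 : j (e.symm ⟨(a.hom - l ∘ₗ K.1.subtype) k, hdiff k⟩) = _ :=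
        congrArg Subtype.val (e.apply_symm_apply ⟨(a.hom - l ∘ₗ K.1.subtype) k, hdiff k⟩)
      change l k.1 + j (d k.1) = a.hom k
      refine (congrArg (l k.1 + ·) (h1.trans h2)).trans ?_
      simp
    · change π (l x + j (d x)) = b.hom x
      rw [map_add, hsB.exact.apply_apply_eq_zero, add_zero]
      exact LinearMap.congr_fun hl x
  have := fac.hi _ hrlp
  have sq : CommSq (0 : ModuleCat.of R M ⟶ ModuleCat.of R J) fac.i (ModuleCat.ofHom π)
      (ModuleCat.ofHom (φ ∘ₗ (LinearMap.range fac.i.hom).mkQ)) :=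
    ⟨ModuleCat.hom_ext (LinearMap.ext fun m => by
      have : (LinearMap.range fac.i.hom).mkQ (fac.i.hom m) = 0 := hs.exact.apply_apply_eq_zero m
      change π 0 = φ ((LinearMap.range fac.i.hom).mkQ (fac.i.hom m))
      rw [this, map_zero, map_zero])⟩
  refine ⟨(LinearMap.range fac.i.hom).liftQ sq.lift.hom ?_, ?_⟩
  · rintro _ ⟨m, rfl⟩
    exact LinearMap.congr_fun (congrArg ModuleCat.Hom.hom sq.fac_left) m
  · refine LinearMap.ext fun x => ?_
    obtain ⟨x, rfl⟩ := hs.surj x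
    exact LinearMap.congr_fun (congrArg ModuleCat.Hom.hom sq.fac_right) x

end Completeness

/-! ### Salce's pushout argument and the cotorsion pair of `TorZero S` -/

section Salce

variable {R : Type u} [Ring R]

/-- The pushout of two short exact sequences with the same left term. -/
theorem IsSES.exists_pushout {X Y Z Y' Z' : Type u} [AddCommGroup X] [Module R X]
    [AddCommGroup Y] [Module R Y] [AddCommGroup Z] [Module R Z] [AddCommGroup Y'] [Module R Y']
    [AddCommGroup Z'] [Module R Z'] {i : X →ₗ[R] Y} {p : Y →ₗ[R] Z} {j : X →ₗ[R] Y'}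
    {q : Y' →ₗ[R] Z'} (h : IsSES i p) (h' : IsSES j q) :
    ∃ (W : Type u) (_ : AddCommGroup W) (_ : Module R W) (a : Y →ₗ[R] W) (b : Y' →ₗ[R] W)
      (c : W →ₗ[R] Z') (d : W →ₗ[R] Z), IsSES a c ∧ IsSES b d := by
  let H : Submodule R (Y × Y') := LinearMap.range (i.prod (-j))
  have hmem : ∀ y y', (y, y') ∈ H ↔ ∃ x, i x = y ∧ -j x = y' := fun y y' => by
    simp [H, LinearMap.mem_range, Prod.ext_iff]
  have hc : H ≤ LinearMap.ker (q ∘ₗ LinearMap.snd R Y Y') := by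
    rintro _ ⟨x, rfl⟩
    simp [h'.exact.apply_apply_eq_zero]
  have hd : H ≤ LinearMap.ker (p ∘ₗ LinearMap.fst R Y Y') := by
    rintro _ ⟨x, rfl⟩
    simp [h.exact.apply_apply_eq_zero]
  refine ⟨(Y × Y') ⧸ H, inferInstance, inferInstance, H.mkQ ∘ₗ LinearMap.inl R Y Y',
    H.mkQ ∘ₗ LinearMap.inr R Y Y', H.liftQ _ hc, H.liftQ _ hd, ⟨?_, fun w => ?_, fun z => ?_⟩,
    ⟨?_, fun w => ?_, fun z => ?_⟩⟩
  · rw [injective_iff_map_eq_zero]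
    intro y hy
    obtain ⟨x, rfl, hx⟩ := (hmem _ _).mp ((Submodule.Quotient.mk_eq_zero H).mp hy)
    rw [h'.inj ((neg_eq_zero.mp hx : j x = 0).trans (map_zero j).symm), map_zero]
  · obtain ⟨⟨y, y'⟩, rfl⟩ := H.mkQ_surjective w
    constructor
    · intro hw
      obtain ⟨x, rfl⟩ := (h'.exact y').mp hw
      refine ⟨y + i x, ?_⟩
      refine (Submodule.Quotient.eq H).mpr ((hmem _ _).mpr ⟨x, ?_, ?_⟩) <;> simp
    · rintro ⟨y, hy⟩
      rw [← hy]
      exact map_zero q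
  · obtain ⟨y', rfl⟩ := h'.surj z
    exact ⟨H.mkQ (0, y'), rfl⟩
  · rw [injective_iff_map_eq_zero]
    intro y' hy'
    obtain ⟨x, hx, rfl⟩ := (hmem _ _).mp ((Submodule.Quotient.mk_eq_zero H).mp hy')
    rw [h.inj (hx.trans (map_zero i).symm), map_zero, neg_zero]
  · obtain ⟨⟨y, y'⟩, rfl⟩ := H.mkQ_surjective w
    constructor
    · intro hw
      obtain ⟨x, rfl⟩ := (h.exact y).mp hw
      refine ⟨y' + j x, ?_⟩
      refine (Submodule.Quotient.eq H).mpr ((hmem _ _).mpr ⟨-x, ?_, ?_⟩) <;> simp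
    · rintro ⟨y, hy⟩
      rw [← hy]
      exact map_zero p
  · obtain ⟨y, rfl⟩ := h.surj z
    exact ⟨H.mkQ (y, 0), rfl⟩

variable (S : ObjectProperty (ModuleCat.{u} Rᵐᵒᵖ))

/-- Special `TorZero S`-precovers exist. -/
theorem exists_special_precover (M : Type u) [AddCommGroup M] [Module R M] :
    ∃ (C : Type u) (_ : AddCommGroup C) (_ : Module R C) (G : Type u) (_ : AddCommGroup G)
      (_ : Module R G) (i : C →ₗ[R] G) (p : G →ₗ[R] M),
      IsSES i p ∧ TorPerp S C ∧ TorZero S G := by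
  have hM := isSES_free R M
  obtain ⟨C, _, _, F, _, _, j, q, hs, hC, hF⟩ := exists_special_preenvelope S
    (LinearMap.ker (Finsupp.linearCombination R (id : M → M)))
  -- W is an extension of F by a free module, hence in the class, and it maps onto M with kernel C.
  obtain ⟨W, _, _, a, b, c, d, h₁, h₂⟩ := hM.exists_pushout hs
  exact ⟨C, _, _, W, _, _, b, d, h₂, hC, h₁.torZero_mid TorZero.of_projective hF⟩

variable {S} {C : Type u} [AddCommGroup C] [Module R C]

/-- Syzygies of members of `TorZero S` stay in it, so degree one implies all degrees. -/
theorem TorPerp.extZero (hC : TorPerp S C) (n : ℕ) : ∀ (X : Type u) [AddCommGroup X]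
    [Module R X], TorZero S X → ExtZero R X C (n + 1) := by
  induction n with
  | zero => exact hC
  | succ n ih =>
    intro X _ _ hX
    have hs := isSES_free R X
    exact hs.ext_right' (ih _ (hs.torZero_left TorZero.of_projective hX))
      (ExtZero.of_projective _)

variable {X Y Z : Type u} [AddCommGroup X] [Module R X] [AddCommGroup Y] [Module R Y]
  [AddCommGroup Z] [Module R Z]

theorem IsSES.torPerp_right {i : X →ₗ[R] Y} {p : Y →ₗ[R] Z} (h : IsSES i p) (hX : TorPerp S X)
    (hY : TorPerp S Y) : TorPerp S Z :=
  fun A _ _ hA => h.ext_right (hY A hA) (hX.extZero 1 A hA)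

theorem IsSES.torPerp_mid {i : X →ₗ[R] Y} {p : Y →ₗ[R] Z} (h : IsSES i p) (hX : TorPerp S X)
    (hZ : TorPerp S Z) : TorPerp S Y :=
  fun A _ _ hA => h.ext_mid (hX A hA) (hZ A hA)

variable (R S) in
/-- The class `TorZero S` is the left half of a complete hereditary cotorsion pair. -/
theorem isCompleteHereditaryCotorsionPair_torZero :
    IsCompleteHereditaryCotorsionPair (fun M : ModuleCat.{u} R => TorZero S M)
      (rightPerp fun M : ModuleCat.{u} R => TorZero S M) := by
  have hperp : ∀ C : ModuleCat.{u} R,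
      rightPerp (fun M : ModuleCat.{u} R => TorZero S M) C ↔ TorPerp S C := fun C =>
    ⟨fun h X _ _ hX => h (ModuleCat.of R X) hX, fun h A hA => h A hA⟩
  constructor
  · refine ⟨rfl, le_antisymm (fun M hM B hB => hB M hM) fun M hM => ?_⟩
    exact torZero_of_extZero_one fun B _ _ hB => hM (ModuleCat.of R B) ((hperp _).mpr hB)
  · intro M
    obtain ⟨C, _, _, G, _, _, i, p, hs, hC, hG⟩ := exists_special_precover S M
    exact ⟨ModuleCat.of R C, ModuleCat.of R G, i, p, (hperp _).mpr hC, hG, hs.inj, hs.exact,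
      hs.surj⟩
  · intro M
    obtain ⟨C, _, _, G, _, _, i, p, hs, hC, hG⟩ := exists_special_preenvelope S M
    exact ⟨ModuleCat.of R C, ModuleCat.of R G, i, p, (hperp _).mpr hC, hG, hs.inj, hs.exact,
      hs.surj⟩
  · exact fun X Y Z i p hi he hp hY hZ => IsSES.torZero_left ⟨hi, he, hp⟩ hY hZ
  · exact fun X Y Z i p hi he hp hX hY => (hperp _).mpr
      (IsSES.torPerp_right ⟨hi, he, hp⟩ ((hperp _).mp hX) ((hperp _).mp hY))
  · rintro A B hA hB (_ | i) hi
    · omega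
    · exact TorPerp.extZero ((hperp _).mp hB) i A hA

end Salce

/-! ### Flatness as `TorZero` of all right modules -/

section Flatness

variable {R : Type u} [Ring R]

/-- Lambek's criterion: by adjunction, maps F → A⁺ are maps A → F⁺. -/
theorem isFlat_iff_injective_rDual (F : ModuleCat.{u} R) :
    IsFlat F ↔ Module.Injective Rᵐᵒᵖ (RDual F) := by
  rw [isFlat_iff_forall_extend]
  constructor
  · refine fun h => ⟨fun X Y _ _ _ _ f hf g => ?_⟩
    obtain ⟨f', hf'⟩ := h (ModuleCat.of Rᵐᵒᵖ X) (ModuleCat.of Rᵐᵒᵖ Y) f hf (flipLeft g)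
    exact ⟨flipRight f', fun x => RDual.ext fun m =>
      DFunLike.congr_fun (DFunLike.congr_fun hf' m) x⟩
  · intro h A B g hg f
    obtain ⟨k, hk⟩ := h.out g hg (flipRight f)
    exact ⟨flipLeft k, LinearMap.ext fun x => LDual.ext fun a => DFunLike.congr_fun (hk a) x⟩

theorem torZero_top_of_extZero_one {F : Type u} [AddCommGroup F] [Module R F]
    (h : ∀ (W : Type u) [AddCommGroup W] [Module Rᵐᵒᵖ W], ExtZero R F (LDual W) 1) :
    TorZero (⊤ : ObjectProperty (ModuleCat.{u} Rᵐᵒᵖ)) F := by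
  have key : ∀ (n : ℕ) (W : Type u) [AddCommGroup W] [Module Rᵐᵒᵖ W],
      ExtZero R F (LDual W) (n + 1) := by
    intro n
    induction n with
    | zero => exact h
    | succ n ih =>
      intro W _ _
      exact (isSES_free Rᵐᵒᵖ W).lDual.ext_left (ih _)
        (ExtZero.of_injective LDual.injective_of_projective _)
  exact fun W _ n => key n W

theorem torZero_top_iff_isFlat (F : ModuleCat.{u} R) :
    TorZero (⊤ : ObjectProperty (ModuleCat.{u} Rᵐᵒᵖ)) F ↔ IsFlat F := by
  rw [isFlat_iff_forall_extend]
  constructor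
  · intro h A B g hg f
    exact (IsSES.of_injective hg).lDual.exists_lift
      (h (ModuleCat.of Rᵐᵒᵖ (B ⧸ LinearMap.range g)) trivial 0) f
  · refine fun h => torZero_top_of_extZero_one fun W _ _ => ?_
    have hs := isSES_free Rᵐᵒᵖ W
    exact hs.lDual.ext_one_of_lift (ExtZero.of_injective LDual.injective_of_projective 0)
      (h (ModuleCat.of Rᵐᵒᵖ (LinearMap.ker (Finsupp.linearCombination Rᵐᵒᵖ (id : W → W))))
        (ModuleCat.of Rᵐᵒᵖ (W →₀ Rᵐᵒᵖ)) _ hs.inj)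

theorem torZero_top_iff_injective {F : Type u} [AddCommGroup F] [Module R F] :
    TorZero (⊤ : ObjectProperty (ModuleCat.{u} Rᵐᵒᵖ)) F ↔ Module.Injective Rᵐᵒᵖ (RDual F) :=
  (torZero_top_iff_isFlat (ModuleCat.of R F)).trans (isFlat_iff_injective_rDual _)

end Flatness

/-! ### Matrix form of coherence and flatness -/

section Matrices

/-- If homomorphisms into `N` extend along the image of a matrix, then every solution of the
relations of the rows of the matrix comes from the matrix. -/
theorem exists_factor_of_extends {S : Type u} [Ring S] {N : Type u} [AddCommGroup N] [Module S N]
    {q p : ℕ} (A : Fin q → Fin p → S)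
    (H : ∀ f : LinearMap.range (Fintype.linearCombination S A) →ₗ[S] N,
      ∃ g : (Fin p → S) →ₗ[S] N, g ∘ₗ Submodule.subtype _ = f)
    (e : Fin q → N) (he : ∀ v : Fin q → S, (∀ i, ∑ j, v j * A j i = 0) → ∑ j, v j • e j = 0) :
    ∃ e' : Fin p → N, ∀ j, e j = ∑ i, A j i • e' i := by
  set α := Fintype.linearCombination S A with hα
  have hker : LinearMap.ker α ≤ LinearMap.ker (Fintype.linearCombination S e) := fun v hv => by
    rw [LinearMap.mem_ker, Fintype.linearCombination_apply]
    refine he v fun i => ?_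
    simpa [hα, Fintype.linearCombination_apply] using congrFun hv i
  -- The hypothesis on relations makes v ↦ ∑ v_j e_j well defined on the image of A; the extension
  -- to the free module is evaluated on the standard basis.
  obtain ⟨g, hg⟩ := H (((LinearMap.ker α).liftQ _ hker) ∘ₗ α.quotKerEquivRange.symm.toLinearMap)
  refine ⟨fun i => g (Pi.single i 1), fun j => ?_⟩
  have h1 := LinearMap.congr_fun hg ⟨α (Pi.single j 1), ⟨_, rfl⟩⟩
  have h2 : α.quotKerEquivRange.symm ⟨α (Pi.single j 1), ⟨_, rfl⟩⟩ =
      Submodule.Quotient.mk (Pi.single j 1) := by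
    rw [LinearEquiv.symm_apply_eq]; rfl
  simp only [LinearMap.comp_apply, LinearEquiv.coe_coe, h2, Submodule.subtype_apply,
    Submodule.liftQ_apply] at h1
  have h3 : α (Pi.single j 1) = ∑ i, A j i • (Pi.single i (1 : S) : Fin p → S) := by
    rw [hα, Fintype.linearCombination_apply_single, one_smul]
    exact (pi_eq_sum_univ' (A j)).trans (by simp)
  rw [h3, map_sum, Fintype.linearCombination_apply_single, one_smul] at h1
  rw [← h1]
  exact Finset.sum_congr rfl fun i _ => g.map_smul _ _

theorem exists_factor_of_injective {S : Type u} [Ring S] {N : Type u} [AddCommGroup N]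
    [Module S N] (hN : Module.Injective S N) {q p : ℕ} (A : Fin q → Fin p → S)
    (e : Fin q → N) (he : ∀ v : Fin q → S, (∀ i, ∑ j, v j * A j i = 0) → ∑ j, v j • e j = 0) :
    ∃ e' : Fin p → N, ∀ j, e j = ∑ i, A j i • e' i := by
  refine exists_factor_of_extends A (fun f => ?_) e he
  obtain ⟨g, hg⟩ := hN.out _ (Submodule.injective_subtype _) f
  exact ⟨g, LinearMap.ext hg⟩

variable {R : Type u} [Ring R]

/-- The columns of `B` generate the right module of solutions of `A x = 0`. -/
structure MatExact {p q r : ℕ} (A : Fin p → Fin q → R) (B : Fin q → Fin r → R) : Prop where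
  mul_eq_zero : ∀ i k, ∑ j, A i j * B j k = 0
  exists_eq : ∀ x : Fin q → R, (∀ i, ∑ j, A i j * x j = 0) →
    ∃ y : Fin r → R, ∀ j, x j = ∑ k, B j k * y k

/-- The solutions of `A x = 0` in `X` are of the form `B y`. -/
def SolvedBy (X : Type u) [AddCommGroup X] [Module R X] {p q r : ℕ} (A : Fin p → Fin q → R)
    (B : Fin q → Fin r → R) : Prop :=
  ∀ x : Fin q → X, (∀ i, ∑ j, A i j • x j = 0) → ∃ y : Fin r → X, ∀ j, x j = ∑ k, B j k • y k

theorem sum_smul_sum_smul {X : Type*} [AddCommGroup X] [Module R X] {q r : ℕ}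
    (a : Fin q → R) (B : Fin q → Fin r → R) (y : Fin r → X) :
    ∑ j, a j • ∑ k, B j k • y k = ∑ k, (∑ j, a j * B j k) • y k := by
  simp only [Finset.smul_sum, Finset.sum_smul, smul_smul]
  exact Finset.sum_comm

/-- Over a right coherent ring the relations between the columns of a matrix are finitely
generated. -/
theorem IsLeftCoherent.exists_matExact (hR : IsLeftCoherent Rᵐᵒᵖ) {p q : ℕ}
    (A : Fin p → Fin q → R) : ∃ (r : ℕ) (B : Fin q → Fin r → R), MatExact A B := by
  have hrow : ∀ {q : ℕ} (a : Fin q → R), ∃ (r : ℕ) (B : Fin q → Fin r → R),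
      (∀ k, ∑ j, a j * B j k = 0) ∧ ∀ x : Fin q → R, ∑ j, a j * x j = 0 →
        ∃ y : Fin r → R, ∀ j, x j = ∑ k, B j k * y k := by
    intro q a
    let φ : (Fin q → Rᵐᵒᵖ) →ₗ[Rᵐᵒᵖ] Rᵐᵒᵖ :=
      Fintype.linearCombination Rᵐᵒᵖ fun j => MulOpposite.op (a j)
    have hφ : ∀ v, φ v = MulOpposite.op (∑ j, a j * (v j).unop) := fun v => by
      rw [Fintype.linearCombination_apply, Finset.op_sum]; rfl
    have hfg : (LinearMap.range φ).FG := (Submodule.fg_top _).mp (by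
      have : Module.Finite Rᵐᵒᵖ (LinearMap.range φ) := inferInstance
      exact this.fg_top)
    have hfp := hR _ hfg
    have hker : (LinearMap.ker φ.rangeRestrict).FG :=
      Module.FinitePresentation.fg_ker _ φ.surjective_rangeRestrict
    rw [LinearMap.ker_rangeRestrict] at hker
    obtain ⟨r, b, hb⟩ := Submodule.fg_iff_exists_fin_generating_family.mp hker
    refine ⟨r, fun j k => (b k j).unop, fun k => ?_, fun x hx => ?_⟩
    · have : b k ∈ LinearMap.ker φ := hb ▸ Submodule.subset_span ⟨k, rfl⟩
      rw [LinearMap.mem_ker, hφ] at this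
      exact MulOpposite.op_injective this
    · have : (fun j => MulOpposite.op (x j)) ∈ LinearMap.ker φ := by
        rw [LinearMap.mem_ker, hφ]
        exact congrArg MulOpposite.op hx
      rw [← hb, Submodule.mem_span_range_iff_exists_fun] at this
      obtain ⟨c, hc⟩ := this
      refine ⟨fun k => (c k).unop, fun j => ?_⟩
      have := congrArg MulOpposite.unop (congrFun hc j)
      simpa using this.symm
  induction p generalizing q with
  | zero =>
    -- Without equations every vector is a solution, so B is the identity matrix.
    refine ⟨q, fun j k => if j = k then 1 else 0, fun i => i.elim0, fun x _ => ⟨x, by simp⟩⟩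
  | succ p ih =>
    -- The solutions of the first row are parametrized by `B₁` and substituted into the other rows.
    obtain ⟨r₁, B₁, h₁, h₁'⟩ := hrow (A 0)
    obtain ⟨r, B₂, h₂⟩ := ih fun i k => ∑ j, A i.succ j * B₁ j k
    have hass : ∀ (a : Fin q → R) (k : Fin r), ∑ j, a j * ∑ l, B₁ j l * B₂ l k =
        ∑ l, (∑ j, a j * B₁ j l) * B₂ l k := fun a k =>
      sum_smul_sum_smul a B₁ fun l => B₂ l k
    refine ⟨r, fun j k => ∑ l, B₁ j l * B₂ l k, fun i k => ?_, fun x hx => ?_⟩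
    · rw [hass]
      refine Fin.cases ?_ (fun i => ?_) i
      · simp [h₁]
      · exact h₂.mul_eq_zero i k
    · obtain ⟨y, hy⟩ := h₁' x (hx 0)
      obtain ⟨z, hz⟩ := h₂.exists_eq y fun i => by
        refine Eq.trans ?_ (hx i.succ)
        simp only [hy]
        exact (sum_smul_sum_smul (A i.succ) B₁ y).symm
      refine ⟨z, fun j => ?_⟩
      rw [hy]
      simp only [hz]
      exact sum_smul_sum_smul (B₁ j) B₂ z

section

variable {X : Type u} [AddCommGroup X] [Module R X] {p q r : ℕ} {A : Fin p → Fin q → R}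
  {B : Fin q → Fin r → R}

/-- A character of X^q that vanishes on the image of B has components in X⁺ compatible with the
relations of A; as X⁺ is injective, the character factors through A and kills every solution. -/
theorem solvedBy_of_injective_rDual (hX : Module.Injective Rᵐᵒᵖ (RDual X)) (h : MatExact A B) :
    SolvedBy X A B := by
  intro x hx
  let β : (Fin r → X) →+ (Fin q → X) :=
    AddMonoidHom.mk' (fun y j => ∑ k, B j k • y k) fun a b => funext fun j => by
      simp [smul_add, Finset.sum_add_distrib]
  suffices hmem : x ∈ β.range by
    obtain ⟨y, hy⟩ := hmem
    exact ⟨y, fun j => (congrFun hy j).symm⟩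
  refine mem_of_forall_character fun χ hχ => ?_
  have hχsum : ∀ z : Fin q → X, χ z = ∑ j, χ (Pi.single j (z j)) := fun z => by
    rw [← map_sum, Finset.univ_sum_single]
  obtain ⟨e, he⟩ := exists_factor_of_injective hX (fun j i => MulOpposite.op (A i j))
    (fun j => (χ.comp (AddMonoidHom.single (fun _ => X) j) : RDual X)) fun v hv => by
      obtain ⟨y, hy⟩ := h.exists_eq (fun j => (v j).unop) fun i => by
        have := congrArg MulOpposite.unop (hv i)
        simpa using this
      refine RDual.ext fun m => ?_
      rw [RDual.sum_apply]
      refine (hχsum (fun j => (v j).unop • m)).symm.trans (hχ _ ⟨fun k => y k • m, ?_⟩)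
      funext j
      simp [β, hy, Finset.sum_smul, smul_smul]
  have : ∀ j, χ (Pi.single j (x j)) = ∑ i, e i (A i j • x j) := fun j => by
    refine (DFunLike.congr_fun (he j) (x j)).trans ?_
    rw [RDual.sum_apply]; rfl
  rw [hχsum]
  simp only [this]
  rw [Finset.sum_comm]
  refine Finset.sum_eq_zero fun i _ => ?_
  rw [← map_sum, hx, map_zero]

/-- The equational criterion for flatness over a right coherent ring. -/
theorem injective_rDual_of_solvedBy (hR : IsLeftCoherent Rᵐᵒᵖ)
    (h : ∀ (p q r : ℕ) (A : Fin p → Fin q → R) (B : Fin q → Fin r → R), MatExact A B →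
      SolvedBy X A B) : Module.Injective Rᵐᵒᵖ (RDual X) := by
  classical
  refine Module.Baer.injective fun I b => ?_
  -- `g` and `χ` model I ⊗ X → X and the character of I ⊗ X given by `b`. If `χ` vanishes on the
  -- kernel of `g`, the factor `ψ` in X⁺ serves as the image of 1.
  let g : (I →₀ X) →+ X := Finsupp.liftAddHom fun a : I =>
    AddMonoidHom.mk' (fun x => (a : Rᵐᵒᵖ).unop • x) fun x y => smul_add _ x y
  let χ : (I →₀ X) →+ UnitAddCircle := Finsupp.liftAddHom fun a : I =>
    AddMonoidHom.mk' (fun x => b a x) (map_add (b a))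
  obtain ⟨ψ, hψ⟩ := exists_character_factor g χ fun z hz => by
    let e := z.support.equivFin
    obtain ⟨r, B, hB⟩ := hR.exists_matExact
      fun (_ : Fin 1) j => ((e.symm j : I) : Rᵐᵒᵖ).unop
    have hz' : ∑ j, ((e.symm j : I) : Rᵐᵒᵖ).unop • z (e.symm j) = 0 := by
      rw [← hz, Finsupp.liftAddHom_apply, Finsupp.sum, ← Finset.sum_coe_sort z.support,
        ← Equiv.sum_comp e.symm]
      rfl
    obtain ⟨y, hy⟩ := h _ _ _ _ _ hB (fun j => z (e.symm j)) fun _ => hz'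
    have hχ : χ z = ∑ j, b (e.symm j) (z (e.symm j)) := by
      rw [Finsupp.liftAddHom_apply, Finsupp.sum, ← Finset.sum_coe_sort z.support,
        ← Equiv.sum_comp e.symm]
      rfl
    have hterm : ∀ j, b (e.symm j) (z (e.symm j)) =
        ∑ k, b (MulOpposite.op (B j k) • (e.symm j : I)) (y k) := fun j => by
      rw [hy, map_sum]
      exact Finset.sum_congr rfl fun k _ => by rw [b.map_smul]; rfl
    rw [hχ, Finset.sum_congr rfl fun j _ => hterm j, Finset.sum_comm]
    refine Finset.sum_eq_zero fun k _ => ?_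
    rw [← RDual.sum_apply, ← map_sum]
    have : ∑ j, MulOpposite.op (B j k) • (e.symm j : I) = 0 := Subtype.ext (by
      rw [← Submodule.subtype_apply, map_sum]
      refine MulOpposite.unop_injective ?_
      rw [Finset.unop_sum]
      exact hB.mul_eq_zero 0 k)
    rw [this, map_zero, RDual.zero_apply]
  refine ⟨LinearMap.toSpanSingleton Rᵐᵒᵖ (RDual X) (ψ : RDual X), fun a ha => ?_⟩
  refine RDual.ext fun x => ?_
  have := hψ (Finsupp.single ⟨a, ha⟩ x)
  simp only [g, χ, Finsupp.liftAddHom_apply_single] at this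
  exact this

/-- The matrix B does not depend on the factor, so solutions are chosen coordinatewise; this gives
flatness of products of flat modules. -/
theorem solvedBy_pi {ι : Type u} {F : ι → Type u} [∀ i, AddCommGroup (F i)]
    [∀ i, Module R (F i)] (h : ∀ i, SolvedBy (F i) A B) : SolvedBy (∀ i, F i) A B := by
  intro x hx
  choose y hy using fun i => h i (fun j => x j i) fun l => by simpa using congrFun (hx l) i
  exact ⟨fun k i => y i k, fun j => funext fun i => by simp [hy i j]⟩

/-- A tuple in E⁺ is a character of E^q. Injectivity of E writes each element killed by the
transpose of B through A, where the character vanishes, so the character factors through that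
transpose. -/
theorem solvedBy_lDual {E : Type u} [AddCommGroup E] [Module Rᵐᵒᵖ E]
    (hE : Module.Injective Rᵐᵒᵖ E) (h : MatExact A B) : SolvedBy (LDual E) A B := by
  intro x hx
  let χ : (Fin q → E) →+ UnitAddCircle := AddMonoidHom.mk' (fun e => ∑ j, x j (e j)) fun a b => by
    simp [Finset.sum_add_distrib]
  let β : (Fin q → E) →+ (Fin r → E) :=
    AddMonoidHom.mk' (fun e k => ∑ j, MulOpposite.op (B j k) • e j) fun a b => funext fun k => by
      simp [smul_add, Finset.sum_add_distrib]
  obtain ⟨ψ, hψ⟩ := exists_character_factor β χ fun e he => by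
    obtain ⟨e', he'⟩ := exists_factor_of_injective hE (fun j i => MulOpposite.op (A i j)) e
      fun v hv => by
        obtain ⟨y, hy⟩ := h.exists_eq (fun j => (v j).unop) fun i => by
          have := congrArg MulOpposite.unop (hv i)
          simpa using this
        have hv' : ∀ j, v j = ∑ k, MulOpposite.op (y k) * MulOpposite.op (B j k) := fun j =>
          MulOpposite.unop_injective (by simp [hy])
        simp only [hv', Finset.sum_smul, mul_smul]
        rw [Finset.sum_comm]
        refine Finset.sum_eq_zero fun k _ => ?_
        rw [← Finset.smul_sum]
        have : ∑ j, MulOpposite.op (B j k) • e j = 0 := congrFun he k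
        rw [this, smul_zero]
    change ∑ j, x j (e j) = 0
    simp only [he', map_sum]
    rw [Finset.sum_comm]
    refine Finset.sum_eq_zero fun i _ => ?_
    have := DFunLike.congr_fun (hx i) (e' i)
    rwa [LDual.sum_apply] at this
  refine ⟨fun k => (ψ.comp (AddMonoidHom.single (fun _ => E) k) : LDual E), fun j => ?_⟩
  refine LDual.ext fun e => ?_
  have h1 : χ (Pi.single j e) = x j e := by
    change ∑ l, x l ((Pi.single j e : Fin q → E) l) = _
    rw [Finset.sum_eq_single j] <;> simp +contextual
  rw [LDual.sum_apply, ← h1, ← hψ, ← Finset.univ_sum_single (β (Pi.single j e)), map_sum]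
  refine Finset.sum_congr rfl fun k _ => ?_
  have h2 : β (Pi.single j e) k = MulOpposite.op (B j k) • e := by
    change ∑ l, MulOpposite.op (B l k) • (Pi.single j e : Fin q → E) l = _
    rw [Finset.sum_eq_single j] <;> simp +contextual
  rw [h2]; rfl

end

end Matrices

/-! ### Flat dimension of injective modules -/

section Dimension

variable {R : Type u} [Ring R]

variable (R) in
/-- The module presented by the columns of a matrix, as a right module. -/
abbrev ColumnCokernel {p q : ℕ} (A : Fin p → Fin q → R) : Type u :=
  (Fin p → Rᵐᵒᵖ) ⧸ LinearMap.range
    (Fintype.linearCombination Rᵐᵒᵖ fun (j : Fin q) (i : Fin p) => MulOpposite.op (A i j))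

/-- `A` is the last matrix of an exact chain of `d + 1` matrices. -/
def IsSyzygyMatrix : ℕ → ∀ {p q : ℕ}, (Fin p → Fin q → R) → Prop
  | 0, _, _, _ => True
  | d + 1, p, _, A => ∃ (p' : ℕ) (A' : Fin p' → Fin p → R), IsSyzygyMatrix d A' ∧ MatExact A' A

theorem columnMap_apply_eq_zero_iff {p q : ℕ} (A : Fin p → Fin q → R) (v : Fin q → Rᵐᵒᵖ) :
    Fintype.linearCombination Rᵐᵒᵖ (fun (j : Fin q) (i : Fin p) => MulOpposite.op (A i j)) v = 0 ↔
      ∀ i, ∑ j, A i j * (v j).unop = 0 := by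
  rw [funext_iff]
  refine forall_congr' fun i => ?_
  rw [Fintype.linearCombination_apply, Pi.zero_apply, ← MulOpposite.unop_eq_zero_iff]
  simp

theorem MatExact.range_eq_ker {p q r : ℕ} {A : Fin p → Fin q → R} {B : Fin q → Fin r → R}
    (h : MatExact A B) :
    LinearMap.range (Fintype.linearCombination Rᵐᵒᵖ fun k j => MulOpposite.op (B j k)) =
      LinearMap.ker (Fintype.linearCombination Rᵐᵒᵖ fun j i => MulOpposite.op (A i j)) := by
  ext v
  rw [LinearMap.mem_ker, columnMap_apply_eq_zero_iff]
  constructor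
  · rintro ⟨y, rfl⟩ i
    have := sum_smul_sum_smul (A i) B fun k => (y k).unop
    simp only [smul_eq_mul] at this
    simpa [Fintype.linearCombination_apply, h.mul_eq_zero] using this
  · intro hv
    obtain ⟨y, hy⟩ := h.exists_eq _ hv
    refine ⟨fun k => MulOpposite.op (y k), funext fun j => MulOpposite.unop_injective ?_⟩
    simp [Fintype.linearCombination_apply, hy]

/-- By exactness, the cokernel of `A` embeds as the image of `A'` in a free module with quotient the
cokernel of `A'`; each link of the chain shifts Ext by one degree. -/
theorem extZero_columnCokernel {N : Type u} [AddCommGroup N] [Module Rᵐᵒᵖ N] (d : ℕ) :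
    ∀ (m : ℕ) {p q : ℕ} (A : Fin p → Fin q → R), IsSyzygyMatrix d A →
      (∀ (W : Type u) [AddCommGroup W] [Module Rᵐᵒᵖ W], Module.FinitePresentation Rᵐᵒᵖ W →
        ExtZero Rᵐᵒᵖ W N (d + m + 1)) → ExtZero Rᵐᵒᵖ (ColumnCokernel R A) N (m + 1) := by
  induction d with
  | zero =>
    intro m p q A _ h
    rw [Nat.zero_add] at h
    exact h _ (Module.finitePresentation_of_surjective _ (Submodule.mkQ_surjective _) (by
      rw [Submodule.ker_mkQ]
      exact (Submodule.fg_top _).mp (Module.Finite.fg_top)))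
  | succ d ih =>
    rintro m p q A ⟨p', A', hA', hAA'⟩ h
    set α' := Fintype.linearCombination Rᵐᵒᵖ
      fun (j : Fin p) (i : Fin p') => MulOpposite.op (A' i j)
    have hs := IsSES.of_injective (i := (LinearMap.ker α').liftQ α' le_rfl)
      (LinearMap.ker_eq_bot.mp (Submodule.ker_liftQ_eq_bot _ _ _ le_rfl))
    have hr : LinearMap.range ((LinearMap.ker α').liftQ α' le_rfl) = LinearMap.range α' :=
      Submodule.range_liftQ _ _ _
    have h1 : ExtZero Rᵐᵒᵖ (ColumnCokernel R A') N (m + 1 + 1) :=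
      ih (m + 1) A' hA' fun W _ _ hW => by
        have := h W hW
        rwa [show d + 1 + m + 1 = d + (m + 1) + 1 by omega] at this
    have h2 := hs.ext_left' (N := N) (n := m + 1) (ExtZero.of_projective m)
      (h1.congr_left (Submodule.quotEquivOfEq _ _ hr.symm))
    exact h2.congr_left (Submodule.quotEquivOfEq _ _ hAA'.range_eq_ker.symm)

/-- The vanishing of `Ext^(d+1)(W, R)` for all finitely presented right modules `W`, in terms of
matrices. -/
theorem exists_row_factor {d : ℕ}
    (hR : ∀ (W : Type u) [AddCommGroup W] [Module Rᵐᵒᵖ W], Module.FinitePresentation Rᵐᵒᵖ W →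
      ExtZero Rᵐᵒᵖ W R (d + 1))
    {p q r : ℕ} {A : Fin p → Fin q → R} {B : Fin q → Fin r → R} (hA : IsSyzygyMatrix d A)
    (h : MatExact A B) (v : Fin q → R) (hv : ∀ k, ∑ j, v j * B j k = 0) :
    ∃ u : Fin p → R, ∀ j, v j = ∑ i, u i * A i j := by
  have hext := extZero_columnCokernel (N := R) d 0 A hA hR
  -- As v kills the image of B, which is the kernel of A, it defines a map from the image of A to R;
  -- Ext^1 vanishing extends it, giving u.
  obtain ⟨u, hu⟩ := exists_factor_of_extends (S := Rᵐᵒᵖ) (N := R)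
    (fun j i => MulOpposite.op (A i j)) ((IsSES.of_submodule _).exists_extend hext) v fun w hw => by
      obtain ⟨y, hy⟩ := h.exists_eq (fun j => (w j).unop) fun i => by
          have := congrArg MulOpposite.unop (hw i)
          simpa using this
      have := sum_smul_sum_smul v B y
      simp only [smul_eq_mul, hv, zero_mul, Finset.sum_const_zero, ← hy] at this
      exact this
  exact ⟨u, hu⟩

variable (R) in
/-- `Tor_(d+1)(W, X) = 0` for all finitely presented right modules `W`, in terms of matrices. -/
def SyzygySolvable (d : ℕ) (X : Type u) [AddCommGroup X] [Module R X] : Prop :=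
  ∀ (p q r : ℕ) (A : Fin p → Fin q → R) (B : Fin q → Fin r → R), IsSyzygyMatrix d A →
    MatExact A B → SolvedBy X A B

/-- A row v with vB = 0 is of the form uA, so it kills every solution of Ax = 0; injectivity of I
then produces y with x = By. -/
theorem syzygySolvable_of_injective {d : ℕ}
    (hR : ∀ (W : Type u) [AddCommGroup W] [Module Rᵐᵒᵖ W], Module.FinitePresentation Rᵐᵒᵖ W →
      ExtZero Rᵐᵒᵖ W R (d + 1)) {I : Type u} [AddCommGroup I] [Module R I]
    (hI : Module.Injective R I) : SyzygySolvable R d I := by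
  intro p q r A B hA h x hx
  refine exists_factor_of_injective hI B x fun v hv => ?_
  obtain ⟨u, hu⟩ := exists_row_factor hR hA h v hv
  simp only [hu]
  rw [← sum_smul_sum_smul u A x]
  simp [hx]

variable {K F X : Type u} [AddCommGroup K] [Module R K] [AddCommGroup F] [Module R F]
  [AddCommGroup X] [Module R X]

/-- Tor_(d+2)(W, X) = Tor_(d+1)(W, K) in elements: k = Bf in F, the image of f in X is Cy with BC =
0, and subtracting C times a lift of y moves f into K. -/
theorem IsSES.syzygySolvable (hR : IsLeftCoherent Rᵐᵒᵖ) {i : K →ₗ[R] F} {p : F →ₗ[R] X}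
    (h : IsSES i p) (hF : Module.Injective Rᵐᵒᵖ (RDual F)) {d : ℕ}
    (hX : SyzygySolvable R (d + 1) X) : SyzygySolvable R d K := by
  intro m q r A B hA hAB k hk
  obtain ⟨s, C, hBC⟩ := hR.exists_matExact B
  obtain ⟨f, hf⟩ := solvedBy_of_injective_rDual hF hAB (fun j => i (k j)) fun l => by
    simpa using congrArg i (hk l)
  obtain ⟨y, hy⟩ := hX _ _ _ B C ⟨m, A, hA, hAB⟩ hBC (fun l => p (f l)) fun j => by
    simpa [h.exact.apply_apply_eq_zero] using (congrArg p (hf j)).symm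
  choose z hz using fun l => h.surj (y l)
  have hmem : ∀ l, ∃ g : K, i g = f l - ∑ n, C l n • z n := fun l =>
    (h.exact _).mp (by simp [hy l, hz])
  choose g hg using hmem
  refine ⟨g, fun j => h.inj ?_⟩
  rw [hf, map_sum]
  simp only [map_smul, hg, smul_sub, Finset.sum_sub_distrib]
  rw [sum_smul_sum_smul (B j) C z]
  simp [hBC.mul_eq_zero]

/-- `SyzygySolvable R d X` bounds the flat dimension of `X` by `d`. -/
theorem SyzygySolvable.extZero (hR : IsLeftCoherent Rᵐᵒᵖ) (d : ℕ) :
    ∀ (X : Type u) [AddCommGroup X] [Module R X], SyzygySolvable R d X →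
      ∀ (W : Type u) [AddCommGroup W] [Module Rᵐᵒᵖ W] (n : ℕ),
        ExtZero R X (LDual W) (d + n + 1) := by
  induction d with
  | zero =>
    intro X _ _ hX W _ _ n
    rw [Nat.zero_add]
    exact torZero_top_iff_injective.mpr (injective_rDual_of_solvedBy hR
      fun p q r A B hAB => hX p q r A B trivial hAB) (ModuleCat.of Rᵐᵒᵖ W) trivial n
  | succ d ih =>
    intro X _ _ hX W _ _ n
    have hs := isSES_free R X
    have hK := ih _ (hs.syzygySolvable hR
      (torZero_top_iff_injective.mp TorZero.of_projective) hX) W n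
    rw [show d + 1 + n + 1 = d + n + 1 + 1 by omega]
    exact hs.ext_right' hK (ExtZero.of_projective _)

end Dimension

/-! ### Flat cotorsion modules, flat embeddings and cosyzygies -/

section FlatCotorsion

variable {R : Type u} [Ring R]

variable (R) in
/-- The class of injective right modules. -/
def injectiveModules : ObjectProperty (ModuleCat.{u} Rᵐᵒᵖ) := fun E => Module.Injective Rᵐᵒᵖ E

variable (R) in
/-- The class of all right modules; `TorZero (allModules R)` is the class of flat modules. -/
abbrev allModules : ObjectProperty (ModuleCat.{u} Rᵐᵒᵖ) := ⊤

theorem torZero_lDual (hR : IsLeftCoherent Rᵐᵒᵖ) {E : Type u} [AddCommGroup E] [Module Rᵐᵒᵖ E]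
    (hE : Module.Injective Rᵐᵒᵖ E) : TorZero (allModules R) (LDual E) :=
  torZero_top_iff_injective.mpr
    (injective_rDual_of_solvedBy hR fun _ _ _ _ _ h => solvedBy_lDual hE h)

/-- A flat cotorsion module over a right coherent ring is right orthogonal to `G` if
`Tor_n(E, G) = 0` for all injective `E` and `n ≥ 1`. -/
theorem extZero_of_flat_cotorsion (hR : IsLeftCoherent Rᵐᵒᵖ) {F G : Type u} [AddCommGroup F]
    [Module R F] [AddCommGroup G] [Module R G] (hF : TorZero (allModules R) F)
    (hF' : TorPerp (allModules R) F) (hG : TorZero (injectiveModules R) G) (n : ℕ) :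
    ExtZero R G F (n + 1) := by
  let i : F →ₗ[R] LDual (RDual F) := flipLeft LinearMap.id
  have hi : Function.Injective i := by
    rw [injective_iff_map_eq_zero]
    intro x hx
    by_contra hx0
    obtain ⟨χ, hχ⟩ := exists_character_ne_zero hx0
    exact hχ (DFunLike.congr_fun hx χ)
  have hinj := torZero_top_iff_injective.mp hF
  have hs := IsSES.of_injective hi
  -- Every map F → W⁺ extends to F⁺⁺ by adjunction, and F⁺⁺ is flat because F⁺ is injective; so the
  -- quotient is flat, and cotorsion of F splits the embedding.
  have hQ : TorZero (allModules R) (LDual (RDual F) ⧸ LinearMap.range i) :=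
    torZero_top_of_extZero_one fun W _ _ =>
      hs.ext_one_of_extend (torZero_lDual hR hinj (ModuleCat.of Rᵐᵒᵖ W) trivial 0) fun f =>
        ⟨LDual.map (flipRight f), rfl⟩
  obtain ⟨r, hr⟩ := hs.exists_extend (hF' _ hQ) LinearMap.id
  exact (hG (ModuleCat.of Rᵐᵒᵖ (RDual F)) hinj n).of_retract_right i r
    fun x => LinearMap.congr_fun hr x

/-- Induction on the bound `m` for the flat dimension of K. In a special flat precover the middle
term is flat and, as an extension of cotorsion modules, cotorsion; the kernel is cotorsion with
bound one lower. -/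
theorem extZero_of_cotorsion (hR : IsLeftCoherent Rᵐᵒᵖ) {G : Type u} [AddCommGroup G] [Module R G]
    (hG : TorZero (injectiveModules R) G) (m : ℕ) :
    ∀ (K : Type u) [AddCommGroup K] [Module R K], TorPerp (allModules R) K →
      (∀ (W : Type u) [AddCommGroup W] [Module Rᵐᵒᵖ W] (n : ℕ),
        ExtZero R K (LDual W) (m + n + 1)) → ∀ n : ℕ, ExtZero R G K (n + 1) := by
  induction m with
  | zero =>
    intro K _ _ hK hd n
    refine extZero_of_flat_cotorsion hR (torZero_top_of_extZero_one fun W _ _ => hd W 0) hK hG n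
  | succ m ih =>
    intro K _ _ hK hd n
    obtain ⟨K', _, _, F, _, _, i, p, hs, hK', hF⟩ := exists_special_precover (allModules R) K
    refine hs.ext_right (extZero_of_flat_cotorsion hR hF (hs.torPerp_mid hK' hK) hG n)
      (ih K' hK' (fun W _ _ l => hs.ext_left' (hF (ModuleCat.of Rᵐᵒᵖ W) trivial _) ?_) (n + 1))
    have := hd W l
    rwa [show m + 1 + l + 1 = m + l + 1 + 1 by omega] at this

variable {M : Type u} [AddCommGroup M] [Module R M]

theorem TorZero.exists_flat_embedding (hR : IsLeftCoherent Rᵐᵒᵖ) {d : ℕ}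
    (hd : ∀ (W : Type u) [AddCommGroup W] [Module Rᵐᵒᵖ W], Module.FinitePresentation Rᵐᵒᵖ W →
      ExtZero Rᵐᵒᵖ W R (d + 1)) (hM : TorZero (injectiveModules R) M) :
    ∃ (F : Type u) (_ : AddCommGroup F) (_ : Module R F) (i : M →ₗ[R] F),
      TorZero (allModules R) F ∧ Function.Injective i := by
  obtain ⟨I, _, _, j, hI, hj⟩ := exists_injective_embedding R M
  obtain ⟨K, _, _, F, _, _, i, p, hs, hK, hF⟩ := exists_special_precover (allModules R) I
  have hI' := SyzygySolvable.extZero hR d I (syzygySolvable_of_injective hd hI)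
  obtain ⟨g, hg⟩ := hs.exists_lift (extZero_of_cotorsion hR hM d K hK (fun W _ _ l =>
    hs.ext_left' (hF (ModuleCat.of Rᵐᵒᵖ W) trivial _) (hI' W (l + 1))) 0) j
  refine ⟨F, _, _, g, hF, ?_⟩
  rw [← hg] at hj
  exact Function.Injective.of_comp hj

variable (R M) in
/-- The flat quotients of a fixed large free module, with a homomorphism from `M`. -/
def SmallFlatTargets : Type u :=
  Σ K : {K : Submodule R (PureTerm R M →₀ R) // TorZero (allModules R) ((PureTerm R M →₀ R) ⧸ K)},
    M →ₗ[R] (PureTerm R M →₀ R) ⧸ K.1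

/-- The underlying flat module. -/
def SmallFlatTargets.Target (t : SmallFlatTargets R M) : Type u := (PureTerm R M →₀ R) ⧸ t.1.1

noncomputable instance (t : SmallFlatTargets R M) : AddCommGroup t.Target :=
  inferInstanceAs (AddCommGroup ((PureTerm R M →₀ R) ⧸ t.1.1))

noncomputable instance (t : SmallFlatTargets R M) : Module R t.Target :=
  inferInstanceAs (Module R ((PureTerm R M →₀ R) ⧸ t.1.1))

/-- The given homomorphism to the flat module. -/
def SmallFlatTargets.hom (t : SmallFlatTargets R M) : M →ₗ[R] t.Target := t.2

theorem SmallFlatTargets.torZero (t : SmallFlatTargets R M) : TorZero (allModules R) t.Target :=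
  t.1.2

/-- The image lies in a pure submodule of Q, flat again and of size bounded in terms of M. So a set
of flat targets suffices for a preenvelope. -/
theorem exists_factor_smallFlatTargets {Q : Type u} [AddCommGroup Q] [Module R Q]
    (hQ : TorZero (allModules R) Q) (f : M →ₗ[R] Q) : ∃ (t : SmallFlatTargets R M)
      (g : t.Target →ₗ[R] Q), g ∘ₗ t.hom = f := by
  obtain ⟨N, hN, hf, p, hp⟩ := exists_isPure (R := R) f
  let e := p.quotKerEquivOfSurjective hp
  let t : SmallFlatTargets R M := ⟨⟨LinearMap.ker p, (hQ.submodule hN).congr e.symm⟩,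
    e.symm.toLinearMap ∘ₗ f.codRestrict N hf⟩
  let g : t.Target →ₗ[R] Q := N.subtype ∘ₗ e.toLinearMap
  exact ⟨t, g, LinearMap.ext fun m => congrArg Subtype.val (e.apply_symm_apply _)⟩

/-- The product of all small flat targets is a flat preenvelope of M. For injective E the dual E⁺ is
flat, so maps M → E⁺ extend and Ext^1(M', E⁺) = 0. -/
theorem TorZero.exists_cosyzygy (hR : IsLeftCoherent Rᵐᵒᵖ) {d : ℕ}
    (hd : ∀ (W : Type u) [AddCommGroup W] [Module Rᵐᵒᵖ W], Module.FinitePresentation Rᵐᵒᵖ W →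
      ExtZero Rᵐᵒᵖ W R (d + 1)) (hM : TorZero (injectiveModules R) M) :
    ∃ (F : Type u) (_ : AddCommGroup F) (_ : Module R F) (M' : Type u) (_ : AddCommGroup M')
      (_ : Module R M') (i : M →ₗ[R] F) (p : F →ₗ[R] M'),
      IsSES i p ∧ TorZero (allModules R) F ∧ TorZero (injectiveModules R) M' := by
  let F : Type u := ∀ t : SmallFlatTargets R M, t.Target
  let j : M →ₗ[R] F := LinearMap.pi fun t => t.hom
  have hF : TorZero (allModules R) F := torZero_top_iff_injective.mpr
    (injective_rDual_of_solvedBy hR fun _ _ _ _ _ h => solvedBy_pi fun t =>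
      solvedBy_of_injective_rDual (torZero_top_iff_injective.mp t.torZero) h)
  have hext : ∀ {Q : Type u} [AddCommGroup Q] [Module R Q], TorZero (allModules R) Q →
      ∀ f : M →ₗ[R] Q, ∃ g : F →ₗ[R] Q, g ∘ₗ j = f := fun hQ f => by
    obtain ⟨t, g, hg⟩ := exists_factor_smallFlatTargets hQ f
    exact ⟨g ∘ₗ LinearMap.proj t, hg⟩
  have hj : Function.Injective j := by
    obtain ⟨F₀, _, _, i, hF₀, hi⟩ := hM.exists_flat_embedding hR hd
    obtain ⟨g, hg⟩ := hext hF₀ i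
    rw [← hg] at hi
    exact Function.Injective.of_comp hi
  have hs := IsSES.of_injective hj
  refine ⟨F, _, _, _, _, _, j, _, hs, hF, fun E hE n => ?_⟩
  cases n with
  | zero => exact hs.ext_one_of_extend (hF E trivial 0) (hext (torZero_lDual hR hE))
  | succ n => exact hs.ext_right' (hM E hE n) (hF E trivial (n + 1))

end FlatCotorsion

/-! ### Gorenstein flat modules are the modules in `TorZero (injectiveModules R)` -/

section Complexes

variable {R : Type u} [Ring R]

theorem IsSES.exists_desc {X Y Z N : Type u} [AddCommGroup X] [Module R X] [AddCommGroup Y]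
    [Module R Y] [AddCommGroup Z] [Module R Z] [AddCommGroup N] [Module R N] {i : X →ₗ[R] Y}
    {p : Y →ₗ[R] Z} (h : IsSES i p) (f : Y →ₗ[R] N) (hf : f ∘ₗ i = 0) :
    ∃ g : Z →ₗ[R] N, g ∘ₗ p = f := by
  have hle : LinearMap.ker p ≤ LinearMap.ker f := fun y hy => by
    obtain ⟨x, rfl⟩ := (h.exact y).mp hy
    exact LinearMap.congr_fun hf x
  let e := p.quotKerEquivOfSurjective h.surj
  refine ⟨(LinearMap.ker p).liftQ f hle ∘ₗ e.symm.toLinearMap, LinearMap.ext fun y => ?_⟩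
  have : e.symm (p y) = Submodule.Quotient.mk y := (LinearEquiv.symm_apply_eq e).mpr rfl
  simp [this]

/-- Splicing short exact sequences with flat middle terms. -/
theorem gorensteinFlat_of_isSES (Z F : ℤ → ModuleCat.{u} R) (i : ∀ k, Z k →ₗ[R] F k)
    (p : ∀ k, F k →ₗ[R] Z (k + 1)) (hs : ∀ k, IsSES (i k) (p k))
    (hF : ∀ k, TorZero (allModules R) (F k)) (hZ : ∀ k, TorZero (injectiveModules R) (Z k)) :
    gorensteinFlat R (Z 0) := by
  have hker : ∀ k x, i (k + 1) (p k x) = 0 ↔ p k x = 0 := fun k x =>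
    map_eq_zero_iff _ (hs (k + 1)).inj
  have hex : ∀ k, Function.Exact (i (k + 1) ∘ₗ p k) (i (k + 1 + 1) ∘ₗ p (k + 1)) := fun k x => by
    rw [LinearMap.comp_apply, hker, (hs (k + 1)).exact x]
    constructor
    · rintro ⟨z, rfl⟩
      obtain ⟨y, rfl⟩ := (hs k).surj z
      exact ⟨y, rfl⟩
    · rintro ⟨y, rfl⟩
      exact ⟨p k y, rfl⟩
  refine ⟨F, fun k => i (k + 1) ∘ₗ p k, fun k => (torZero_top_iff_isFlat _).mp (hF k), hex,
    fun E hE k => ?_, ⟨?_⟩⟩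
  · refine (tensor_exact_iff _ _ (LinearMap.ext (hex k).apply_apply_eq_zero)).mpr fun h hh => ?_
    obtain ⟨h', rfl⟩ := (hs (k + 1)).exists_desc h (LinearMap.ext fun z => by
      obtain ⟨y, rfl⟩ := (hs k).surj z
      exact LinearMap.congr_fun hh y)
    -- The map descends to the kernel `Z (k + 2)`, and Ext^1(`Z (k + 3)`, E⁺) = 0 extends it to `F
    -- (k + 2)`.
    obtain ⟨g, rfl⟩ := (hs (k + 1 + 1)).exists_extend (hZ _ E hE 0) h'
    exact ⟨g, rfl⟩
  · refine (LinearEquiv.ofInjective (i 0) (hs 0).inj).trans (LinearEquiv.ofEq _ _ ?_)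
    ext x
    rw [LinearMap.mem_ker, LinearMap.comp_apply, hker]
    exact ((hs 0).exact x).symm

theorem gorensteinFlat.torZero {M : ModuleCat.{u} R} (hM : gorensteinFlat R M) :
    TorZero (injectiveModules R) M := by
  obtain ⟨F, d, hF, hd, ht, ⟨e⟩⟩ := hM
  have hF' := fun k => (torZero_top_iff_isFlat (F k)).mpr (hF k)
  let p : ∀ k, F k →ₗ[R] LinearMap.ker (d (k + 1)) := fun k =>
    (d k).codRestrict _ fun x => (hd k).apply_apply_eq_zero x
  have hs : ∀ k, IsSES (X := LinearMap.ker (d k)) (Y := F k) (Z := LinearMap.ker (d (k + 1)))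
      (LinearMap.ker (d k)).subtype (p k) := fun k =>
    ⟨Submodule.injective_subtype _, fun x => by
      rw [Subtype.ext_iff]
      exact ⟨fun hx => ⟨⟨x, hx⟩, rfl⟩, by rintro ⟨y, rfl⟩; exact y.2⟩, fun x => by
      obtain ⟨y, hy⟩ := (hd k _).mp x.2
      exact ⟨y, Subtype.ext hy⟩⟩
  have key : ∀ E, injectiveModules R E → ∀ (n : ℕ) (k : ℤ),
      ExtZero R (LinearMap.ker (d k)) (LDual E) (n + 1) := by
    intro E hE n
    induction n with
    | zero =>
      intro k
      -- The kernel at k + 3 is F_(k+2) modulo the kernel at k + 2. A map from the latter to E⁺,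
      -- pulled back to F_(k+1), vanishes on the image of F_k, so tensor exactness there extends it
      -- to F_(k+2).
      obtain ⟨k, rfl⟩ : ∃ l, k = l + 1 + 1 + 1 := ⟨k - 1 - 1 - 1, by ring⟩
      refine (hs (k + 1 + 1)).ext_one_of_extend (hF' _ E trivial 0) fun f => ?_
      obtain ⟨g, hg⟩ := (tensor_exact_iff (d k) (d (k + 1))
        (LinearMap.ext (hd k).apply_apply_eq_zero)).mp (ht E hE k) (f ∘ₗ p (k + 1))
        (LinearMap.ext fun x => by
          have : p (k + 1) (d k x) = 0 := Subtype.ext ((hd k).apply_apply_eq_zero x)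
          simp [this])
      refine ⟨g, LinearMap.ext fun z => ?_⟩
      obtain ⟨y, rfl⟩ := (hs (k + 1)).surj z
      exact LinearMap.congr_fun hg y
    | succ n ih =>
      intro k
      obtain ⟨k, rfl⟩ : ∃ l, k = l + 1 := ⟨k - 1, by ring⟩
      exact (hs k).ext_right' (ih k) (hF' k E trivial (n + 1))
  exact fun E hE n => (key E hE n 0).congr_left e.symm

theorem gorensteinFlat_of_torZero (hR : IsLeftCoherent Rᵐᵒᵖ) {d : ℕ}
    (hd : ∀ (W : Type u) [AddCommGroup W] [Module Rᵐᵒᵖ W], Module.FinitePresentation Rᵐᵒᵖ W →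
      ExtZero Rᵐᵒᵖ W R (d + 1)) {M : ModuleCat.{u} R} (hM : TorZero (injectiveModules R) M) :
    gorensteinFlat R M := by
  let Obj := {M : ModuleCat.{u} R // TorZero (injectiveModules R) M}
  have hnext : ∀ X : Obj, ∃ (Y : Obj) (F : ModuleCat.{u} R) (i : X.1 →ₗ[R] F)
      (p : F →ₗ[R] Y.1), IsSES i p ∧ TorZero (allModules R) F := fun X => by
    obtain ⟨F, _, _, M', _, _, i, p, hs, hF, hM'⟩ := X.2.exists_cosyzygy hR hd
    exact ⟨⟨ModuleCat.of R M', hM'⟩, ModuleCat.of R F, i, p, hs, hF⟩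
  have hprev : ∀ X : Obj, ∃ (Y : Obj) (F : ModuleCat.{u} R) (i : Y.1 →ₗ[R] F)
      (p : F →ₗ[R] X.1), IsSES i p ∧ TorZero (allModules R) F := fun X =>
    have hs := isSES_free R X.1
    ⟨⟨ModuleCat.of R _, hs.torZero_left TorZero.of_projective X.2⟩,
      ModuleCat.of R (X.1 →₀ R), _, _, hs, TorZero.of_projective⟩
  choose next Fn inx pn hn using hnext
  choose prev Fp ip pp hp using hprev
  let Z : ℤ → Obj := fun k => match k with
    | Int.ofNat n => next^[n] ⟨M, hM⟩
    | Int.negSucc n => prev^[n + 1] ⟨M, hM⟩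
  have hZ : ∀ k : ℤ, ∃ (F : ModuleCat.{u} R) (i : (Z k).1 →ₗ[R] F) (p : F →ₗ[R] (Z (k + 1)).1),
      IsSES i p ∧ TorZero (allModules R) F := by
    rintro (n | n)
    · have : Z (Int.ofNat n + 1) = next (Z (Int.ofNat n)) :=
        Function.iterate_succ_apply' next n _
      rw [this]
      exact ⟨_, _, _, hn _⟩
    · have h1 : Z (Int.negSucc n) = prev (prev^[n] ⟨M, hM⟩) :=
        Function.iterate_succ_apply' prev n _
      have h2 : Z (Int.negSucc n + 1) = prev^[n] ⟨M, hM⟩ := by cases n <;> rfl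
      rw [h1, h2]
      exact ⟨_, _, _, hp _⟩
  choose F i p h using hZ
  exact gorensteinFlat_of_isSES (fun k => (Z k).1) F i p (fun k => (h k).1) (fun k => (h k).2)
    fun k => (Z k).2

end Complexes

theorem IsDingChenRing.exists_extZero {R : Type u} [Ring R] (hR : IsDingChenRing R) :
    IsLeftCoherent Rᵐᵒᵖ ∧ ∃ d : ℕ, ∀ (W : Type u) [AddCommGroup W] [Module Rᵐᵒᵖ W],
      Module.FinitePresentation Rᵐᵒᵖ W → ExtZero Rᵐᵒᵖ W R (d + 1) := by
  obtain ⟨n, h⟩ := hR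
  refine ⟨h.right_coherent, ?_⟩
  have hdim := h.right_dim
  unfold fpInjDim at hdim
  have hne : Set.Nonempty {m : ℕ∞ | ∃ n : ℕ, m = n ∧ ∀ F : ModuleCat.{u} Rᵐᵒᵖ,
      Module.FinitePresentation Rᵐᵒᵖ F →
        Subsingleton (Abelian.Ext F (ModuleCat.of Rᵐᵒᵖ R) (n + 1))} := by
    -- The infimum of the empty set in ℕ∞ is ⊤, so a finite dimension forces some degree d + 1 of
    -- vanishing.
    by_contra hempty
    rw [Set.not_nonempty_iff_eq_empty.mp hempty, sInf_empty] at hdim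
    exact ENat.natCast_ne_top n hdim.symm
  obtain ⟨_, d, -, hd⟩ := hne
  exact ⟨d, fun W _ _ hW => hd (ModuleCat.of Rᵐᵒᵖ W) hW⟩

end DingChen

theorem mainTheorem9 (R : Type u) [Ring R] (hR : DingChen.IsDingChenRing R) :
    DingChen.IsCompleteHereditaryCotorsionPair
      (DingChen.gorensteinFlat R) (DingChen.gorensteinCotorsion R) := by
  obtain ⟨hcoh, d, hd⟩ := hR.exists_extZero
  have heq : DingChen.gorensteinFlat R =
      fun M : ModuleCat.{u} R => DingChen.TorZero (DingChen.injectiveModules R) M :=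
    funext fun M => propext ⟨DingChen.gorensteinFlat.torZero,
      DingChen.gorensteinFlat_of_torZero hcoh hd⟩
  unfold DingChen.gorensteinCotorsion
  rw [heq]
  exact DingChen.isCompleteHereditaryCotorsionPair_torZero R _
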